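/- Let $s=\sigma+it$. The extended Selberg class $S$ consists of the not identically vanishing Dirichlet series $F(s)=\sum_{n\ge1}a_nn^{-s}$, absolutely convergent for $\sigma>1$, such that $(s-1)^kF(s)$ is an entire function of finite order for some $k\in\mathbb N$, and such that for some $Q>0$, $|\omega|=1$, $\lambda_j>0$ and $\mu_j\in\mathbb C$ with $\Re\mu_j\ge0$ $(1\le j\le m)$ $$\Phi(s)=\omega\,\overline{\Phi(1-\overline s)},\qquad \Phi(s)=F(s)\,Q^s\prod_{j=1}^m\Gamma(\lambda_js+\mu_j).\tag{1}$$ Fix real constants $\sigma_1>1$ and $c,B,\varepsilon,\delta,\overline T>0$, and fix $\lambda_j>0$ and $\mu_j\in\mathbb C$ with $\Re\mu_j\ge0$ $(1\le j\le m)$. Let $\overline S\subset S$ be the set of all $F\in S$ such that - $|F(\sigma_1+it)|\ge c$ for all $t\in\mathbb R$; - $|F(\sigma+iT)|<T^B$ for all $T>10$ and $\sigma\ge-4\sigma_1$; - $F$ satisfies (1) with the given $\lambda_j,\mu_j$, with some $Q>0$ and some $|\omega|=1$; - for every $T>\overline T$, $F$ has at most $\dfrac{\varepsilon}{\log(2+\delta)}\log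 T-2$ zeros in $|t-T|\le 1/T$. All zeros are counted with multiplicity. Assume that the degree $d_F=2\sum_{j=1}^m\lambda_j$, which is common to all $F\in\overline S$, is positive. Then there is a constant $T_0=T_0(\overline S)>0$, depending only on $\sigma_1,c,B,\varepsilon,\delta,\overline T,\lambda_j,\mu_j$, such that the following holds for every $F\in\overline S$. If $A$ and $s_0=\sigma_0+iT$ satisfy $$A>\varepsilon,\qquad T>T_0,\qquad \tfrac12-\exp(-T^A)<\sigma_0\le\tfrac12,$$ then there is a radius $r$ (which may depend on $F$, $A$ and $s_0$) with $$\exp(-T^A)\le r\le\exp(-T^{A-\varepsilon})$$ such that $F$ and $F'$ have the same (finite) number of zeros in $\{s:|s-s_0|\le r,\ \sigma<\tfrac12\}$. -/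

import Mathlib

open Complex

/-- `G` has finite order of growth: `G(s) = O(exp(|s|^ρ))` for some real `ρ ≥ 0`. -/
def HasFiniteOrder (G : ℂ → ℂ) : Prop :=
  ∃ C ρ : ℝ, 0 ≤ ρ ∧ ∀ s : ℂ, ‖G s‖ ≤ C * Real.exp (‖s‖ ^ ρ)

/-- No factor `Γ(λ_j s + μ_j)` has a pole at `s`. -/
def GammaRegular {r : ℕ} (lam : Fin r → ℝ) (mu : Fin r → ℂ) (s : ℂ) : Prop :=
  ∀ (j : Fin r) (m : ℕ), (lam j : ℂ) * s + mu j ≠ -(m : ℂ)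

/-- `Φ(s) = F(s) Q^s ∏_j Γ(λ_j s + μ_j)`. -/
noncomputable def completed (F : ℂ → ℂ) (Q : ℝ) {r : ℕ} (lam : Fin r → ℝ) (mu : Fin r → ℂ)
    (s : ℂ) : ℂ :=
  F s * (Q : ℂ) ^ s * ∏ j, Gamma ((lam j : ℂ) * s + mu j)

/-- The functional equation `Φ(s) = ω * conj (Φ(1 - conj s))`, an identity of meromorphic functions.
It is required at every `s` at which neither side involves a pole of a Gamma factor or the value of
`F` at its possible pole `1`. -/
def FunctionalEquation (F : ℂ → ℂ) (Q : ℝ) (ω : ℂ) {r : ℕ} (lam : Fin r → ℝ) (mu : Fin r → ℂ) :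
    Prop :=
  ∀ s : ℂ, s ≠ 0 → s ≠ 1 → GammaRegular lam mu s →
    GammaRegular lam mu (1 - starRingEnd ℂ s) →
    completed F Q lam mu s =
      ω * starRingEnd ℂ (completed F Q lam mu (1 - starRingEnd ℂ s))

/-- The extended Selberg class. An element is given as a function on `ℂ`, namely the meromorphic
continuation of its Dirichlet series; its value at the possible pole `1` plays no role. -/
structure IsExtendedSelberg (F : ℂ → ℂ) : Prop where
  /-- `F` is an absolutely convergent Dirichlet series for `σ > 1`. -/
  dirichlet : ∃ a : ℕ → ℂ, ∀ s : ℂ, 1 < s.re → LSeriesSummable a s ∧ F s = LSeries a s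
  /-- `F` does not vanish identically. -/
  ne_zero : ∃ s : ℂ, 1 < s.re ∧ F s ≠ 0
  /-- For some `k`, `(s-1)^k F(s)` is an entire function of finite order. -/
  continuation : ∃ (k : ℕ) (G : ℂ → ℂ), Differentiable ℂ G ∧ HasFiniteOrder G ∧
    ∀ s : ℂ, s ≠ 1 → G s = (s - 1) ^ k * F s
  /-- `F` satisfies a functional equation. -/
  functional : ∃ (r : ℕ) (lam : Fin r → ℝ) (mu : Fin r → ℂ) (Q : ℝ) (ω : ℂ),
    0 < Q ∧ ‖ω‖ = 1 ∧ (∀ j, 0 < lam j) ∧ (∀ j, 0 ≤ (mu j).re) ∧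
      FunctionalEquation F Q ω lam mu

/-- The degree `d_F = 2 ∑_j λ_j` of a function satisfying a functional equation with Gamma factors
`Γ(λ_j s + μ_j)`. -/
noncomputable def selbergDegree {r : ℕ} (lam : Fin r → ℝ) : ℝ := 2 * ∑ j, lam j

/-- The multiplicity of `z` as a zero of the meromorphic function `F`: it is the order of `F` at `z`
if this is positive (`⊤` if `F` vanishes near `z`), and `0` otherwise. -/
noncomputable def zeroMult (F : ℂ → ℂ) (z : ℂ) : ℕ∞ :=
  if meromorphicOrderAt F z = ⊤ then ⊤ else ((meromorphicOrderAt F z).untop₀.toNat : ℕ∞)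

/-- The number of zeros of `F` in `U`, counted with multiplicity. -/
noncomputable def zeroCount (F : ℂ → ℂ) (U : Set ℂ) : ℕ∞ :=
  ⨆ (S : Finset ℂ) (_ : (S : Set ℂ) ⊆ U), ∑ z ∈ S, zeroMult F z

/-- The subclass of the extended Selberg class determined by the constants
`σ₁, c, B, ε, δ, Tbar, λ_j, μ_j`. -/
structure InSubclass (σ₁ c B ε δ Tbar : ℝ) {r : ℕ} (lam : Fin r → ℝ) (mu : Fin r → ℂ)
    (F : ℂ → ℂ) : Prop where
  selberg : IsExtendedSelberg F
  lower : ∀ t : ℝ, c ≤ ‖F ((σ₁ : ℂ) + t * I)‖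
  upper : ∀ σ T : ℝ, 10 < T → -4 * σ₁ ≤ σ → ‖F ((σ : ℂ) + T * I)‖ < T ^ B
  functional : ∃ (Q : ℝ) (ω : ℂ), 0 < Q ∧ ‖ω‖ = 1 ∧ FunctionalEquation F Q ω lam mu
  zeros : ∀ T : ℝ, Tbar < T → ∃ n : ℕ, zeroCount F {s : ℂ | |s.im - T| ≤ 1 / T} = n ∧
    (n : ℝ) ≤ ε / Real.log (2 + δ) * Real.log T - 2

/-! If Re F'/F < 0 on the boundary of a rectangle, then log(-F'/F) is a single-valued primitive of
F''/F' - F'/F there, so F and F' have equally many zeros inside (`zeroCount_closedRect_eq`). It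
therefore suffices to find this sign, and no zeros of F, in all of the half-disc outside such a
rectangle.

On the critical line the functional equation makes Re F'/F equal to minus the sum of log Q and
digamma terms, hence at most -1 at large height (`eventually_logDeriv_re_le`). That height must not
depend on F, so Q has to be bounded below uniformly (`exists_conductor_lower_bound`).

To the left of the line, F'/F is a sum of m(p)/(s - p) over nearby zeros plus the logarithmic
derivative of a zero-free factor; `exists_landau_factorization` bounds the number of zeros and the
variation of the remainder. Zeros on the line contribute nonpositive real parts. The others come in
pairs symmetric in the line, and a pair contributes nothing on the line and a nonpositive amount to
its left outside the disc having the pair as a diameter. Suppose that the off-line zeros avoid the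
annulus of radii r₁ < r around 1/2 + iT. Then the inner ones are harmless beyond distance 2r₁, and
everything else stays close to its value on the line up to distance 2R, if R is much smaller than
r². This gives the sign (`LocalData.zeroCount_eq`).

An empty annulus comes from the pigeonhole principle (`exists_annulus_of_zeroCount_lt`): the radii
are exp(-x₀(14/5)^j), each occupied annulus uses up two zeros, and there are fewer than 2J zeros for
J annuli. The exponents stay below T^A because (14/5)² < 2³ (`pow_floor_mul_le`). -/

/-! ### Contour integrals over rectangles. -/

/-- The integral of `f` along the positively oriented boundary of `[a, b] × [c, d]`. -/
noncomputable def rectIntegral (f : ℂ → ℂ) (a b c d : ℝ) : ℂ :=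
  (∫ x : ℝ in a..b, f (x + c * I)) - (∫ x : ℝ in a..b, f (x + d * I)) +
    I * (∫ y : ℝ in c..d, f (b + y * I)) - I * ∫ y : ℝ in c..d, f (a + y * I)

/-- The closed rectangle `[a, b] × [c, d]`. -/
def closedRect (a b c d : ℝ) : Set ℂ := {z | a ≤ z.re ∧ z.re ≤ b ∧ c ≤ z.im ∧ z.im ≤ d}

/-- The boundary of the rectangle `[a, b] × [c, d]`. -/
def rectBoundary (a b c d : ℝ) : Set ℂ :=
  {z ∈ closedRect a b c d | z.re = a ∨ z.re = b ∨ z.im = c ∨ z.im = d}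

section sides
variable {a b c d : ℝ}

lemma bottom_mem (hcd : c ≤ d) {x : ℝ} (hx : x ∈ Set.Icc a b) :
    (x + c * I : ℂ) ∈ rectBoundary a b c d := by
  simp [rectBoundary, closedRect, hx.1, hx.2, hcd]

lemma top_mem (hcd : c ≤ d) {x : ℝ} (hx : x ∈ Set.Icc a b) :
    (x + d * I : ℂ) ∈ rectBoundary a b c d := by
  simp [rectBoundary, closedRect, hx.1, hx.2, hcd]

lemma right_mem (hab : a ≤ b) {y : ℝ} (hy : y ∈ Set.Icc c d) :
    (b + y * I : ℂ) ∈ rectBoundary a b c d := by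
  simp [rectBoundary, closedRect, hy.1, hy.2, hab]

lemma left_mem (hab : a ≤ b) {y : ℝ} (hy : y ∈ Set.Icc c d) :
    (a + y * I : ℂ) ∈ rectBoundary a b c d := by
  simp [rectBoundary, closedRect, hy.1, hy.2, hab]

lemma sides_integrable (hab : a ≤ b) (hcd : c ≤ d) {f : ℂ → ℂ}
    (hf : ContinuousOn f (rectBoundary a b c d)) :
    IntervalIntegrable (fun x : ℝ => f (x + c * I)) MeasureTheory.volume a b ∧
    IntervalIntegrable (fun x : ℝ => f (x + d * I)) MeasureTheory.volume a b ∧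
    IntervalIntegrable (fun y : ℝ => f (b + y * I)) MeasureTheory.volume c d ∧
    IntervalIntegrable (fun y : ℝ => f (a + y * I)) MeasureTheory.volume c d := by
  refine ⟨?_, ?_, ?_, ?_⟩ <;> refine ContinuousOn.intervalIntegrable ?_ <;>
    simp only [Set.uIcc_of_le hab, Set.uIcc_of_le hcd] <;>
    refine hf.comp (Continuous.continuousOn (by fun_prop)) ?_
  exacts [fun x hx => bottom_mem hcd hx, fun x hx => top_mem hcd hx,
    fun x hx => right_mem hab hx, fun x hx => left_mem hab hx]

lemma rectIntegral_congr (hab : a ≤ b) (hcd : c ≤ d) {f g : ℂ → ℂ}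
    (h : ∀ z ∈ rectBoundary a b c d, f z = g z) :
    rectIntegral f a b c d = rectIntegral g a b c d := by
  unfold rectIntegral
  congr 1; congr 1; congr 1
  · exact intervalIntegral.integral_congr fun x hx =>
      h _ (bottom_mem hcd (by rwa [Set.uIcc_of_le hab] at hx))
  · exact intervalIntegral.integral_congr fun x hx =>
      h _ (top_mem hcd (by rwa [Set.uIcc_of_le hab] at hx))
  · congr 1
    exact intervalIntegral.integral_congr fun x hx =>
      h _ (right_mem hab (by rwa [Set.uIcc_of_le hcd] at hx))
  · congr 1
    exact intervalIntegral.integral_congr fun x hx =>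
      h _ (left_mem hab (by rwa [Set.uIcc_of_le hcd] at hx))

lemma rectIntegral_add (hab : a ≤ b) (hcd : c ≤ d) {f g : ℂ → ℂ}
    (hf : ContinuousOn f (rectBoundary a b c d)) (hg : ContinuousOn g (rectBoundary a b c d)) :
    rectIntegral (fun z => f z + g z) a b c d = rectIntegral f a b c d + rectIntegral g a b c d := by
  obtain ⟨f1, f2, f3, f4⟩ := sides_integrable hab hcd hf
  obtain ⟨g1, g2, g3, g4⟩ := sides_integrable hab hcd hg
  unfold rectIntegral
  rw [intervalIntegral.integral_add f1 g1, intervalIntegral.integral_add f2 g2,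
    intervalIntegral.integral_add f3 g3, intervalIntegral.integral_add f4 g4]
  ring

lemma rectIntegral_const_mul (k : ℂ) (f : ℂ → ℂ) :
    rectIntegral (fun z => k * f z) a b c d = k * rectIntegral f a b c d := by
  unfold rectIntegral
  simp only [intervalIntegral.integral_const_mul]
  ring

lemma rectIntegral_sum (hab : a ≤ b) (hcd : c ≤ d) {ι : Type*} (s : Finset ι) (f : ι → ℂ → ℂ)
    (hf : ∀ i ∈ s, ContinuousOn (f i) (rectBoundary a b c d)) :
    rectIntegral (fun z => ∑ i ∈ s, f i z) a b c d = ∑ i ∈ s, rectIntegral (f i) a b c d := by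
  classical
  induction s using Finset.induction_on with
  | empty => simp [rectIntegral]
  | insert i s his ih =>
    simp only [Finset.sum_insert his]
    rw [rectIntegral_add hab hcd (hf i (Finset.mem_insert_self _ _))
      (continuousOn_finsetSum _ fun j hj => hf j (Finset.mem_insert_of_mem hj)),
      ih fun j hj => hf j (Finset.mem_insert_of_mem hj)]

lemma closedRect_eq (hab : a ≤ b) (hcd : c ≤ d) :
    closedRect a b c d = Set.uIcc a b ×ℂ Set.uIcc c d := by
  ext z
  simp [closedRect, mem_reProdIm, Set.uIcc_of_le hab, Set.uIcc_of_le hcd, and_assoc]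

lemma rectIntegral_eq_zero (hab : a ≤ b) (hcd : c ≤ d) {f : ℂ → ℂ}
    (hf : DifferentiableOn ℂ f (closedRect a b c d)) : rectIntegral f a b c d = 0 := by
  have := integral_boundary_rect_eq_zero_of_differentiableOn f (a + c * I) (b + d * I)
    (by simpa [closedRect_eq hab hcd] using hf)
  simpa [rectIntegral] using this

lemma horizontal_integral (hab : a ≤ b) {f Φ : ℂ → ℂ} (y : ℝ)
    (h : ∀ x ∈ Set.Icc a b, HasDerivAt Φ (f (x + y * I)) (x + y * I))
    (hi : IntervalIntegrable (fun x : ℝ => f (x + y * I)) MeasureTheory.volume a b) :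
    ∫ x : ℝ in a..b, f (x + y * I) = Φ (b + y * I) - Φ (a + y * I) := by
  refine intervalIntegral.integral_eq_sub_of_hasDerivAt (f := fun x : ℝ => Φ (x + y * I)) ?_ hi
  intro x hx
  rw [Set.uIcc_of_le hab] at hx
  have h1 : HasDerivAt (fun z : ℂ => z + y * I) 1 (x : ℂ) := (hasDerivAt_id _).add_const _
  simpa using ((h x hx).comp (x : ℂ) h1).comp_ofReal

lemma vertical_integral (hcd : c ≤ d) {f Φ : ℂ → ℂ} (x : ℝ)
    (h : ∀ y ∈ Set.Icc c d, HasDerivAt Φ (f (x + y * I)) (x + y * I))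
    (hi : IntervalIntegrable (fun y : ℝ => f (x + y * I)) MeasureTheory.volume c d) :
    I * ∫ y : ℝ in c..d, f (x + y * I) = Φ (x + d * I) - Φ (x + c * I) := by
  rw [← intervalIntegral.integral_const_mul]
  refine intervalIntegral.integral_eq_sub_of_hasDerivAt (f := fun y : ℝ => Φ (x + y * I)) ?_
    (hi.const_mul I)
  intro y hy
  rw [Set.uIcc_of_le hcd] at hy
  have h1 : HasDerivAt (fun z : ℂ => x + z * I) I (y : ℂ) := by
    simpa using ((hasDerivAt_id (y : ℂ)).mul_const I).const_add (x : ℂ)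
  simpa [mul_comm] using ((h y hy).comp (y : ℂ) h1).comp_ofReal

/-- The side integrals cancel at the corners. Nothing is required inside the rectangle, so a
logarithm can serve as primitive even when the integrand has poles there. -/
lemma rectIntegral_eq_zero_of_primitive (hab : a ≤ b) (hcd : c ≤ d) {f Φ : ℂ → ℂ}
    (hf : ContinuousOn f (rectBoundary a b c d))
    (h : ∀ z ∈ rectBoundary a b c d, HasDerivAt Φ (f z) z) : rectIntegral f a b c d = 0 := by
  obtain ⟨f1, f2, f3, f4⟩ := sides_integrable hab hcd hf
  unfold rectIntegral
  rw [horizontal_integral hab (Φ := Φ) c (fun x hx => h _ (bottom_mem hcd hx)) f1,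
    horizontal_integral hab (Φ := Φ) d (fun x hx => h _ (top_mem hcd hx)) f2,
    vertical_integral hcd (Φ := Φ) b (fun x hx => h _ (right_mem hab hx)) f3,
    vertical_integral hcd (Φ := Φ) a (fun x hx => h _ (left_mem hab hx)) f4]
  ring

lemma log_I_mul_of_re_pos {u : ℂ} (hu : 0 < u.re) : log (I * u) = log u + Real.pi / 2 * I := by
  have hu0 : u ≠ 0 := by rintro rfl; simp at hu
  have := abs_lt.1 (abs_arg_lt_pi_div_two_iff.2 (Or.inl hu))
  rw [Complex.log_mul I_ne_zero hu0, log_I, add_comm]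
  rw [arg_I]
  constructor <;> linarith [this.1, this.2, Real.pi_pos]

lemma hasDerivAt_log_mul_sub {k p z : ℂ} (h : 0 < (k * (z - p)).re) :
    HasDerivAt (fun z => log (k * (z - p))) (1 / (z - p)) z := by
  have hk : k ≠ 0 := by rintro rfl; simp at h
  have h0 : z - p ≠ 0 := by rintro h'; simp [h'] at h
  have h1 : HasDerivAt (fun z => k * (z - p)) k z := by
    simpa using ((hasDerivAt_id z).sub_const p).const_mul k
  convert h1.clog (Or.inl h) using 1
  field_simp

/-- On each side a rotated logarithm log(k(z - p)) with k = ±1 or ±i is holomorphic, since k(z - p)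
lies in the right half-plane. Consecutive branches differ by πi/2 at the common corner, and the four
jumps add up to 2πi. -/
lemma rectIntegral_inv_sub {p : ℂ} (h1 : a < p.re) (h2 : p.re < b) (h3 : c < p.im)
    (h4 : p.im < d) : rectIntegral (fun z => 1 / (z - p)) a b c d = 2 * Real.pi * I := by
  have hab : a ≤ b := by linarith
  have hcd : c ≤ d := by linarith
  have hc : ContinuousOn (fun z => 1 / (z - p)) (rectBoundary a b c d) := by
    refine ContinuousOn.div (by fun_prop) (by fun_prop) ?_
    rintro z ⟨-, hz⟩ h0
    rw [sub_eq_zero] at h0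
    subst h0
    rcases hz with h | h | h | h <;> linarith
  obtain ⟨f1, f2, f3, f4⟩ := sides_integrable hab hcd hc
  unfold rectIntegral
  rw [horizontal_integral hab (f := fun z => 1 / (z - p)) (Φ := fun z => log (I * (z - p))) c
      (fun x hx => hasDerivAt_log_mul_sub (by simp; linarith)) f1,
    horizontal_integral hab (f := fun z => 1 / (z - p)) (Φ := fun z => log (-I * (z - p))) d
      (fun x hx => hasDerivAt_log_mul_sub (by simp; linarith)) f2,
    vertical_integral hcd (f := fun z => 1 / (z - p)) (Φ := fun z => log (1 * (z - p))) b
      (fun x hx => hasDerivAt_log_mul_sub (by simp; linarith)) f3,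
    vertical_integral hcd (f := fun z => 1 / (z - p)) (Φ := fun z => log (-1 * (z - p))) a
      (fun x hx => hasDerivAt_log_mul_sub (by simp; linarith)) f4]
  have e1 := log_I_mul_of_re_pos (u := b + c * I - p) (by simp; linarith)
  have e2 := log_I_mul_of_re_pos (u := -I * (b + d * I - p)) (by simp; linarith)
  have e3 := log_I_mul_of_re_pos (u := -1 * (a + d * I - p)) (by simp; linarith)
  have e4 := log_I_mul_of_re_pos (u := I * (a + c * I - p)) (by simp; linarith)
  have i1 : I * (-I * (b + d * I - p)) = 1 * (b + d * I - p) := by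
    rw [← mul_assoc]; simp
  have i2 : I * (-1 * (a + d * I - p)) = -I * (a + d * I - p) := by ring
  have i3 : I * (I * (a + c * I - p)) = -1 * (a + c * I - p) := by
    rw [← mul_assoc]; simp
  rw [i1] at e2
  rw [i2] at e3
  rw [i3] at e4
  simp only [e1, e2, e3, e4]
  simp only [one_mul]
  ring

end sides

/-! ### Counting zeros with multiplicity. -/

section counting

lemma zeroMult_eq_analyticOrderAt {F : ℂ → ℂ} {z : ℂ} (h : AnalyticAt ℂ F z) :
    zeroMult F z = analyticOrderAt F z := by
  unfold zeroMult
  rw [h.meromorphicOrderAt_eq]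
  cases hn : analyticOrderAt F z with
  | top => simp
  | coe n => simp

lemma zeroMult_eq_zero {F : ℂ → ℂ} {z : ℂ} (h : AnalyticAt ℂ F z) (h0 : F z ≠ 0) :
    zeroMult F z = 0 := by
  rw [zeroMult_eq_analyticOrderAt h, h.analyticOrderAt_eq_zero]
  exact h0

lemma zeroCount_eq_sum {F : ℂ → ℂ} {U : Set ℂ} {Z : Finset ℂ} (hZ : (Z : Set ℂ) ⊆ U)
    (h : ∀ z ∈ U, z ∉ Z → zeroMult F z = 0) : zeroCount F U = ∑ z ∈ Z, zeroMult F z := by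
  classical
  unfold zeroCount
  apply le_antisymm
  · refine iSup₂_le fun S hS => ?_
    calc ∑ z ∈ S, zeroMult F z = ∑ z ∈ S ∩ Z, zeroMult F z := by
          symm
          refine Finset.sum_subset Finset.inter_subset_left fun z hz hz' => ?_
          exact h z (hS hz) fun hzZ => hz' (Finset.mem_inter.2 ⟨hz, hzZ⟩)
      _ ≤ ∑ z ∈ Z, zeroMult F z := Finset.sum_le_sum_of_subset Finset.inter_subset_right
  · exact le_iSup₂_of_le Z hZ le_rfl

lemma sum_le_zeroCount {F : ℂ → ℂ} {U : Set ℂ} {Z : Finset ℂ} (hZ : (Z : Set ℂ) ⊆ U) :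
    ∑ z ∈ Z, zeroMult F z ≤ zeroCount F U :=
  le_iSup₂_of_le (f := fun (S : Finset ℂ) (_ : (S : Set ℂ) ⊆ U) => ∑ z ∈ S, zeroMult F z)
    Z hZ le_rfl

lemma zeroCount_congr_set {F : ℂ → ℂ} {U V : Set ℂ} (hVU : V ⊆ U)
    (h : ∀ z ∈ U, z ∉ V → zeroMult F z = 0) : zeroCount F U = zeroCount F V := by
  classical
  apply le_antisymm
  · refine iSup₂_le fun S hS => ?_
    calc ∑ z ∈ S, zeroMult F z = ∑ z ∈ S with z ∈ V, zeroMult F z := by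
          symm
          refine Finset.sum_subset (Finset.filter_subset _ _) fun z hz hz' => ?_
          exact h z (hS hz) fun hzV => hz' (Finset.mem_filter.2 ⟨hz, hzV⟩)
      _ ≤ zeroCount F V := sum_le_zeroCount fun z hz => by
          simpa using (Finset.mem_filter.1 (Finset.mem_coe.1 hz)).2
  · exact iSup₂_le fun S hS => sum_le_zeroCount (hS.trans hVU)

end counting

/-! ### Splitting off zeros, and the argument principle. -/

section factorization

lemma exists_eq_pow_mul_of_order {f : ℂ → ℂ} {U : Set ℂ} (hU : IsOpen U)
    (hf : DifferentiableOn ℂ f U) {p : ℂ} (hp : p ∈ U) {n : ℕ} (hn : analyticOrderAt f p = n) :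
    ∃ g : ℂ → ℂ, DifferentiableOn ℂ g U ∧ g p ≠ 0 ∧ ∀ s ∈ U, f s = (s - p) ^ n * g s := by
  have hfa : AnalyticAt ℂ f p := hf.analyticAt (hU.mem_nhds hp)
  obtain ⟨g0, hg0, hg0p, hfg⟩ := hfa.analyticOrderAt_eq_natCast.1 hn
  classical
  -- The quotient has a removable singularity at `p`; the local cofactor `g0` supplies the missing
  -- value.
  set g : ℂ → ℂ := Function.update (fun s => f s / (s - p) ^ n) p (g0 p) with hg
  have hgp : g p = g0 p := by simp [hg]
  have hgne : ∀ s, s ≠ p → g s = f s / (s - p) ^ n := fun s hs => by simp [hg, hs]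
  have hev : g =ᶠ[nhds p] g0 := by
    filter_upwards [hfg] with s hs
    by_cases h : s = p
    · rw [h, hgp]
    · rw [hgne s h, hs, smul_eq_mul, mul_div_cancel_left₀]
      exact pow_ne_zero _ (sub_ne_zero.2 h)
  refine ⟨g, ?_, by rwa [hgp], ?_⟩
  · intro s hs
    by_cases h : s = p
    · subst h
      exact (hg0.differentiableAt.congr_of_eventuallyEq hev).differentiableWithinAt
    · have h1 : DifferentiableAt ℂ (fun s => f s / (s - p) ^ n) s :=
        (hf.differentiableAt (hU.mem_nhds hs)).div (by fun_prop)
          (pow_ne_zero _ (sub_ne_zero.2 h))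
      refine (h1.congr_of_eventuallyEq ?_).differentiableWithinAt
      filter_upwards [isOpen_ne.mem_nhds h] with z hz using hgne z hz
  · intro s hs
    by_cases h : s = p
    · subst h
      rw [hgp]
      simpa using hfg.self_of_nhds
    · rw [hgne s h, mul_div_cancel₀]
      exact pow_ne_zero _ (sub_ne_zero.2 h)

lemma exists_eq_prod_mul_of_order {f : ℂ → ℂ} {U : Set ℂ} (hU : IsOpen U)
    (hf : DifferentiableOn ℂ f U) (m : ℂ → ℕ) (Z : Finset ℂ) (hZU : (Z : Set ℂ) ⊆ U)
    (hm : ∀ p ∈ Z, analyticOrderAt f p = m p) :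
    ∃ g : ℂ → ℂ, DifferentiableOn ℂ g U ∧ (∀ p ∈ Z, g p ≠ 0) ∧
      ∀ s ∈ U, f s = (∏ p ∈ Z, (s - p) ^ m p) * g s := by
  classical
  induction Z using Finset.induction_on with
  | empty => exact ⟨f, hf, by simp, by simp⟩
  | insert q Z hq ih =>
    obtain ⟨g, hg, hgZ, hfg⟩ := ih (fun z hz => hZU (by simp at hz ⊢; exact Or.inr hz))
      fun p hp => hm p (Finset.mem_insert_of_mem hp)
    have hqU : q ∈ U := hZU (by simp)
    have hga : AnalyticAt ℂ g q := hg.analyticAt (hU.mem_nhds hqU)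
    have hPa : AnalyticAt ℂ (fun s => ∏ p ∈ Z, (s - p) ^ m p) q := by fun_prop
    have hPq : (∏ p ∈ Z, (q - p) ^ m p) ≠ 0 := Finset.prod_ne_zero_iff.2 fun p hp =>
      pow_ne_zero _ (sub_ne_zero.2 fun h => hq (h ▸ hp))
    have hord : analyticOrderAt g q = m q := by
      rw [← hm q (Finset.mem_insert_self _ _)]
      have : f =ᶠ[nhds q] (fun s => ∏ p ∈ Z, (s - p) ^ m p) * g := by
        filter_upwards [hU.mem_nhds hqU] with s hs using hfg s hs
      rw [analyticOrderAt_congr this, analyticOrderAt_mul hPa hga,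
        hPa.analyticOrderAt_eq_zero.2 hPq, zero_add]
    obtain ⟨g1, hg1, hg1q, hgg1⟩ := exists_eq_pow_mul_of_order hU hg hqU hord
    refine ⟨g1, hg1, ?_, ?_⟩
    · intro p hp
      rcases Finset.mem_insert.1 hp with rfl | hp
      · exact hg1q
      · intro h0
        apply hgZ p hp
        rw [hgg1 p (hZU (by simp [hp])), h0, mul_zero]
    · intro s hs
      rw [hfg s hs, hgg1 s hs, Finset.prod_insert hq]
      ring

lemma finite_zeros_of_isCompact {f : ℂ → ℂ} {K : Set ℂ} (hK : IsCompact K)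
    (hf : ∀ z ∈ K, AnalyticAt ℂ f z) (hord : ∀ z ∈ K, analyticOrderAt f z ≠ ⊤) :
    {z ∈ K | f z = 0}.Finite := by
  by_contra hinf
  obtain ⟨z, hzK, hz⟩ := Set.Infinite.exists_accPt_of_subset_isCompact hinf hK (Set.sep_subset _ _)
  apply hord z hzK
  rw [analyticOrderAt_eq_top, ← (hf z hzK).frequently_zero_iff_eventually_zero]
  exact (accPt_iff_frequently_nhdsNE.1 hz).mono fun w hw => hw.2

lemma exists_factorization {f : ℂ → ℂ} {U K : Set ℂ} (hU : IsOpen U)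
    (hf : DifferentiableOn ℂ f U) (hK : IsCompact K) (hKU : K ⊆ U)
    (hord : ∀ z ∈ K, analyticOrderAt f z ≠ ⊤) :
    ∃ (Z : Finset ℂ) (m : ℂ → ℕ) (g : ℂ → ℂ), (∀ z, z ∈ Z ↔ z ∈ K ∧ f z = 0) ∧
      (∀ p ∈ Z, analyticOrderAt f p = m p ∧ 1 ≤ m p) ∧ DifferentiableOn ℂ g U ∧
      (∀ z ∈ K, g z ≠ 0) ∧ ∀ s ∈ U, f s = (∏ p ∈ Z, (s - p) ^ m p) * g s := by
  have han : ∀ z ∈ K, AnalyticAt ℂ f z := fun z hz => hf.analyticAt (hU.mem_nhds (hKU hz))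
  have hfin := finite_zeros_of_isCompact hK han hord
  have hmem : ∀ z, z ∈ hfin.toFinset ↔ z ∈ K ∧ f z = 0 := fun z => by simp
  have hm : ∀ p ∈ hfin.toFinset, analyticOrderAt f p = (analyticOrderNatAt f p : ℕ∞) := fun p hp =>
    (Nat.cast_analyticOrderNatAt (hord p ((hmem p).1 hp).1)).symm
  obtain ⟨g, hg, hgZ, hfg⟩ := exists_eq_prod_mul_of_order hU hf (analyticOrderNatAt f)
    hfin.toFinset (fun z hz => hKU ((hmem z).1 hz).1) hm
  refine ⟨hfin.toFinset, analyticOrderNatAt f, g, hmem, fun p hp => ⟨hm p hp, ?_⟩, hg, ?_, hfg⟩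
  · have h1 := ((hmem p).1 hp)
    have := (han p h1.1).analyticOrderAt_ne_zero.2 h1.2
    rw [hm p hp] at this
    exact Nat.one_le_iff_ne_zero.2 (by exact_mod_cast this)
  · intro z hz h0
    by_cases h : z ∈ hfin.toFinset
    · exact hgZ z h h0
    · exact h ((hmem z).2 ⟨hz, by rw [hfg z (hKU hz), h0, mul_zero]⟩)

lemma logDeriv_prod_pow_mul {f g : ℂ → ℂ} {U : Set ℂ} (hU : IsOpen U)
    (hg : DifferentiableOn ℂ g U) {Z : Finset ℂ} {m : ℂ → ℕ}
    (hfg : ∀ s ∈ U, f s = (∏ p ∈ Z, (s - p) ^ m p) * g s) {z : ℂ} (hz : z ∈ U) (hfz : f z ≠ 0) :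
    logDeriv f z = (∑ p ∈ Z, (m p : ℂ) * (1 / (z - p))) + logDeriv g z := by
  have hne := hfz
  rw [hfg z hz] at hne
  have hP := left_ne_zero_of_mul hne
  have hgz := right_ne_zero_of_mul hne
  have hev : f =ᶠ[nhds z] fun s => (∏ p ∈ Z, (s - p) ^ m p) * g s := by
    filter_upwards [hU.mem_nhds hz] with s hs using hfg s hs
  rw [logDeriv_apply, hev.deriv_eq, hev.eq_of_nhds, ← logDeriv_apply,
    logDeriv_mul z hP hgz (by fun_prop) (hg.differentiableAt (hU.mem_nhds hz))]
  congr 1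
  rw [logDeriv_prod]
  · refine Finset.sum_congr rfl fun p _ => ?_
    rw [logDeriv_fun_pow (by fun_prop)]
    simp [logDeriv_apply]
  · exact fun p hp => Finset.prod_ne_zero_iff.1 hP p hp
  · intro p _
    fun_prop

/-- **Argument principle** for a pair of functions whose quotient has negative real part on the
boundary of a rectangle. -/
theorem zeroCount_closedRect_eq {f h : ℂ → ℂ} {U : Set ℂ} (hU : IsOpen U)
    (hf : DifferentiableOn ℂ f U) (hh : DifferentiableOn ℂ h U) {a b c d : ℝ} (hab : a ≤ b)
    (hcd : c ≤ d) (hKU : closedRect a b c d ⊆ U)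
    (hbd : ∀ z ∈ rectBoundary a b c d, (f z / h z).re < 0) :
    ∃ n : ℕ, zeroCount f (closedRect a b c d) = n ∧ zeroCount h (closedRect a b c d) = n := by
  set K := closedRect a b c d with hKdef
  have hKeq : K = Set.uIcc a b ×ℂ Set.uIcc c d := closedRect_eq hab hcd
  have hKc : IsCompact K := by
    rw [hKeq]; exact isCompact_uIcc.reProdIm isCompact_uIcc
  have hKp : IsPreconnected K := by
    rw [hKeq]
    exact (((convex_uIcc a b).linear_preimage reLm).inter
      ((convex_uIcc c d).linear_preimage imLm)).isPreconnected
  have hBK : rectBoundary a b c d ⊆ K := Set.sep_subset _ _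
  have hcorner : (a + c * I : ℂ) ∈ rectBoundary a b c d := bottom_mem hcd ⟨le_rfl, hab⟩
  have hfB : ∀ z ∈ rectBoundary a b c d, f z ≠ 0 := fun z hz h0 => by
    simpa [h0] using hbd z hz
  have hhB : ∀ z ∈ rectBoundary a b c d, h z ≠ 0 := fun z hz h0 => by
    simpa [h0] using hbd z hz
  -- For each of the two functions the zeros are split off: every zero adds 2πi times its
  -- multiplicity, and the zero-free cofactor integrates to zero by Cauchy's theorem.
  have key : ∀ u : ℂ → ℂ, DifferentiableOn ℂ u U → (∀ z ∈ rectBoundary a b c d, u z ≠ 0) →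
      ContinuousOn (logDeriv u) (rectBoundary a b c d) ∧
      ∃ n : ℕ, zeroCount u K = n ∧ rectIntegral (logDeriv u) a b c d = n * (2 * Real.pi * I) := by
    intro u hu huB
    have han : AnalyticOnNhd ℂ u K := fun z hz => hu.analyticAt (hU.mem_nhds (hKU hz))
    have hord : ∀ z ∈ K, analyticOrderAt u z ≠ ⊤ := by
      intro z hz
      refine han.analyticOrderAt_ne_top_of_isPreconnected hKp (hBK hcorner) hz ?_
      rw [(han _ (hBK hcorner)).analyticOrderAt_eq_zero.2 (huB _ hcorner)]
      exact ENat.zero_ne_top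
    obtain ⟨Z, m, g, hZ, hm, hg, hgK, hug⟩ := exists_factorization hU hu hKc hKU hord
    have hZint : ∀ p ∈ Z, a < p.re ∧ p.re < b ∧ c < p.im ∧ p.im < d := by
      intro p hp
      obtain ⟨hpK, hp0⟩ := (hZ p).1 hp
      have hpB : p ∉ rectBoundary a b c d := fun hB => huB p hB hp0
      have hpB' : ¬ (p.re = a ∨ p.re = b ∨ p.im = c ∨ p.im = d) := fun h' => hpB ⟨hpK, h'⟩
      push Not at hpB'
      obtain ⟨k1, k2, k3, k4⟩ := hpK
      exact ⟨lt_of_le_of_ne k1 hpB'.1.symm, lt_of_le_of_ne k2 hpB'.2.1,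
        lt_of_le_of_ne k3 hpB'.2.2.1.symm, lt_of_le_of_ne k4 hpB'.2.2.2⟩
    have hlogg : DifferentiableOn ℂ (logDeriv g) K := fun z hz =>
      (((hg.analyticAt (hU.mem_nhds (hKU hz))).deriv.differentiableAt).div
        (hg.differentiableAt (hU.mem_nhds (hKU hz))) (hgK z hz)).differentiableWithinAt
    have hdec : ∀ z ∈ rectBoundary a b c d,
        logDeriv u z = (∑ p ∈ Z, (m p : ℂ) * (1 / (z - p))) + logDeriv g z := fun z hz =>
      logDeriv_prod_pow_mul hU hg hug (hKU (hBK hz)) (huB z hz)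
    have hterm : ∀ p ∈ Z, ContinuousOn (fun z => 1 / (z - p)) (rectBoundary a b c d) := by
      intro p hp
      refine ContinuousOn.div (by fun_prop) (by fun_prop) fun z hz h0 => ?_
      rw [sub_eq_zero] at h0
      exact huB z hz (h0 ▸ ((hZ p).1 hp).2)
    have hterm' : ∀ p ∈ Z,
        ContinuousOn (fun z => (m p : ℂ) * (1 / (z - p))) (rectBoundary a b c d) :=
      fun p hp => continuousOn_const.mul (hterm p hp)
    refine ⟨?_, ∑ p ∈ Z, m p, ?_, ?_⟩
    · exact ((continuousOn_finsetSum _ hterm').add (hlogg.continuousOn.mono hBK)).congr hdec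
    · rw [zeroCount_eq_sum (Z := Z) (fun z hz => ((hZ z).1 hz).1) fun z hz hzZ =>
        zeroMult_eq_zero (han z hz) fun h0 => hzZ ((hZ z).2 ⟨hz, h0⟩)]
      push_cast
      refine Finset.sum_congr rfl fun p hp => ?_
      rw [zeroMult_eq_analyticOrderAt (han p ((hZ p).1 hp).1), (hm p hp).1]
    · rw [rectIntegral_congr hab hcd hdec,
        rectIntegral_add hab hcd (continuousOn_finsetSum _ hterm') (hlogg.continuousOn.mono hBK),
        rectIntegral_eq_zero hab hcd hlogg, rectIntegral_sum hab hcd _ _ hterm', add_zero]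
      push_cast
      rw [Finset.sum_mul]
      refine Finset.sum_congr rfl fun p hp => ?_
      obtain ⟨k1, k2, k3, k4⟩ := hZint p hp
      rw [rectIntegral_const_mul, rectIntegral_inv_sub k1 k2 k3 k4]
  obtain ⟨cf, nf, hnf, hIf⟩ := key f hf hfB
  obtain ⟨ch, nh, hnh, hIh⟩ := key h hh hhB
  -- -f/h stays in the right half-plane on the boundary, so its principal logarithm is a primitive
  -- of the difference of the logarithmic derivatives.
  have hprim : rectIntegral (fun z => logDeriv f z + (-1) * logDeriv h z) a b c d = 0 := by
    refine rectIntegral_eq_zero_of_primitive hab hcd (cf.add (continuousOn_const.mul ch))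
      (Φ := fun z => log (-(f z / h z))) fun z hz => ?_
    have df := (hf.differentiableAt (hU.mem_nhds (hKU (hBK hz)))).hasDerivAt
    have dh := (hh.differentiableAt (hU.mem_nhds (hKU (hBK hz)))).hasDerivAt
    have hf0 := hfB z hz
    have hh0 := hhB z hz
    refine ((df.div dh hh0).neg.clog (Or.inl (by simpa using hbd z hz))).congr_deriv ?_
    rw [logDeriv_apply, logDeriv_apply, Pi.neg_apply, Pi.div_apply]
    field_simp
    ring
  have ch' : ContinuousOn (fun z => (-1) * logDeriv h z) (rectBoundary a b c d) :=
    continuousOn_const.mul ch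
  rw [rectIntegral_add hab hcd cf ch', rectIntegral_const_mul, hIf, hIh]
    at hprim
  have hne : (2 * Real.pi * I : ℂ) ≠ 0 := Complex.two_pi_I_ne_zero
  have heq : (nf : ℂ) = nh := by
    have : ((nf : ℂ) - nh) * (2 * Real.pi * I) = 0 := by linear_combination hprim
    rcases mul_eq_zero.1 this with h0 | h0
    · linear_combination h0
    · exact absurd h0 hne
  have heq' : nf = nh := by exact_mod_cast heq
  exact ⟨nf, hnf, by rw [hnh, heq']⟩

end factorization

/-! ### Reflection in the critical line and pairs of zeros. -/

/-- The reflection of `z` in the line `σ = 1/2`. -/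
noncomputable def mirror (z : ℂ) : ℂ := 1 - starRingEnd ℂ z

@[simp] lemma mirror_re (z : ℂ) : (mirror z).re = 1 - z.re := by simp [mirror]

@[simp] lemma mirror_im (z : ℂ) : (mirror z).im = z.im := by simp [mirror]

@[simp] lemma mirror_mirror (z : ℂ) : mirror (mirror z) = z := by simp [mirror]

lemma norm_mirror_sub (z : ℂ) (T : ℝ) :
    ‖mirror z - (1 / 2 + T * I)‖ = ‖z - (1 / 2 + T * I)‖ := by
  rw [← Complex.norm_conj (z - _), ← norm_neg]
  congr 1
  apply Complex.ext <;> simp [mirror] <;> ring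

section pairs

lemma re_one_div (w : ℂ) : (1 / w).re = w.re / normSq w := by simp [inv_re]

/-- The last factor of the numerator is the power of `s` with respect to the circle with diameter
from `p` to `mirror p`. It is nonnegative exactly when `s` is not inside that circle. -/
lemma re_one_div_pair {s p : ℂ} (h1 : s ≠ p) (h2 : s ≠ mirror p) :
    (1 / (s - p)).re + (1 / (s - mirror p)).re =
      2 * (s.re - 1 / 2) * ((s.re - 1 / 2) ^ 2 + (s.im - p.im) ^ 2 - (p.re - 1 / 2) ^ 2) /
        (normSq (s - p) * normSq (s - mirror p)) := by
  have k1 : normSq (s - p) ≠ 0 := by simpa [sub_eq_zero] using h1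
  have k2 : normSq (s - mirror p) ≠ 0 := by simpa [sub_eq_zero] using h2
  rw [re_one_div, re_one_div, div_add_div _ _ k1 k2]
  congr 1
  simp only [normSq_apply, sub_re, sub_im, mirror_re, mirror_im]
  ring

lemma re_one_div_pair_nonpos {s p : ℂ} (h1 : s ≠ p) (h2 : s ≠ mirror p) (hx : s.re ≤ 1 / 2)
    (h : (p.re - 1 / 2) ^ 2 ≤ (s.re - 1 / 2) ^ 2 + (s.im - p.im) ^ 2) :
    (1 / (s - p)).re + (1 / (s - mirror p)).re ≤ 0 := by
  rw [re_one_div_pair h1 h2]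
  refine div_nonpos_of_nonpos_of_nonneg ?_ (mul_nonneg (normSq_nonneg _) (normSq_nonneg _))
  exact mul_nonpos_of_nonpos_of_nonneg (by linarith) (by linarith)

lemma re_one_div_pair_eq_zero {s p : ℂ} (h1 : s ≠ p) (h2 : s ≠ mirror p) (hx : s.re = 1 / 2) :
    (1 / (s - p)).re + (1 / (s - mirror p)).re = 0 := by
  rw [re_one_div_pair h1 h2, hx]
  simp

/-- Reindexing by the involution `mirror` replaces single zeros by pairs, to which the sign
statements apply. -/
lemma sum_re_symm {Z : Finset ℂ} {m : ℂ → ℕ} (hZ : ∀ p ∈ Z, mirror p ∈ Z ∧ m (mirror p) = m p)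
    (s : ℂ) : 2 * ∑ p ∈ Z, (m p : ℝ) * (1 / (s - p)).re =
      ∑ p ∈ Z, (m p : ℝ) * ((1 / (s - p)).re + (1 / (s - mirror p)).re) := by
  have : ∑ p ∈ Z, (m p : ℝ) * (1 / (s - mirror p)).re = ∑ p ∈ Z, (m p : ℝ) * (1 / (s - p)).re := by
    refine Finset.sum_nbij' mirror mirror (fun p hp => (hZ p hp).1) (fun p hp => (hZ p hp).1)
      (fun p _ => mirror_mirror p) (fun p _ => mirror_mirror p) fun p hp => ?_
    rw [(hZ p hp).2]
  simp only [mul_add, Finset.sum_add_distrib, this]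
  ring

end pairs

lemma exists_pos_le_abs {Z : Finset ℂ} (hZ : ∀ p ∈ Z, p.re ≠ 1 / 2) :
    ∃ β : ℝ, 0 < β ∧ ∀ p ∈ Z, β ≤ |p.re - 1 / 2| := by
  classical
  induction Z using Finset.induction_on with
  | empty => exact ⟨1, one_pos, by simp⟩
  | insert q Z _ ih =>
    obtain ⟨β, hβ, h⟩ := ih fun p hp => hZ p (Finset.mem_insert_of_mem hp)
    refine ⟨min β |q.re - 1 / 2|, lt_min hβ (abs_pos.2 (sub_ne_zero.2 (hZ q (by simp)))), ?_⟩
    intro p hp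
    rcases Finset.mem_insert.1 hp with rfl | hp
    · exact min_le_right _ _
    · exact (min_le_left _ _).trans (h p hp)

/-! ### The local argument near a point of the critical line. -/

/-- A function on the unit disc around a point of the critical line, with its zeros split off, whose
logarithmic derivative has negative real part on the critical line and whose zeros off the line
avoid an annulus. -/
structure LocalData (F : ℂ → ℂ) (T N V r r₁ R : ℝ) (Z : Finset ℂ) (m : ℂ → ℕ) (H : ℂ → ℂ) :
    Prop where
  diff_H : DifferentiableOn ℂ H (Metric.ball (1 / 2 + T * I) 1)
  H_ne_zero : ∀ s ∈ Metric.ball (1 / 2 + T * I : ℂ) 1, H s ≠ 0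
  eq : ∀ s ∈ Metric.ball (1 / 2 + T * I : ℂ) 1, F s = (∏ p ∈ Z, (s - p) ^ m p) * H s
  one_le : ∀ p ∈ Z, 1 ≤ m p
  sum_le : ∑ p ∈ Z, (m p : ℝ) ≤ N
  deriv_le : ∀ s ∈ Metric.ball (1 / 2 + T * I : ℂ) (1 / 2), ‖deriv (logDeriv H) s‖ ≤ V
  line : ∀ s ∈ Metric.ball (1 / 2 + T * I : ℂ) (1 / 2), s.re = 1 / 2 → F s ≠ 0 →
    (logDeriv F s).re ≤ -1
  off_line : ∀ p ∈ Z, p.re ≠ 1 / 2 → ‖p - (1 / 2 + T * I)‖ < r →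
    ‖p - (1 / 2 + T * I)‖ ≤ r₁ ∧ mirror p ∈ Z ∧ m (mirror p) = m p
  r₁_pos : 0 < r₁
  r₁_le : 8 * r₁ ≤ R
  R_le : 4 * R ≤ r
  r_le : r ≤ 1
  small : (4 * N / r ^ 2 + V) * (2 * R) ≤ 1 / 2

namespace LocalData

variable {F : ℂ → ℂ} {T N V r r₁ R : ℝ} {Z : Finset ℂ} {m : ℂ → ℕ} {H : ℂ → ℂ}

/-- The zeros on the critical line. -/
noncomputable def onLine (Z : Finset ℂ) : Finset ℂ := by
  classical exact {p ∈ Z | p.re = 1 / 2}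

/-- The zeros off the critical line at distance less than `r` from `1/2 + iT`. -/
noncomputable def near (Z : Finset ℂ) (T r : ℝ) : Finset ℂ := by
  classical exact {p ∈ Z | p.re ≠ 1 / 2 ∧ ‖p - (1 / 2 + T * I)‖ < r}

/-- The zeros off the critical line at distance at least `r` from `1/2 + iT`. -/
noncomputable def far (Z : Finset ℂ) (T r : ℝ) : Finset ℂ := by
  classical exact {p ∈ Z | p.re ≠ 1 / 2 ∧ r ≤ ‖p - (1 / 2 + T * I)‖}

lemma mem_onLine {p : ℂ} : p ∈ onLine Z ↔ p ∈ Z ∧ p.re = 1 / 2 := by simp [onLine]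

lemma mem_near {p : ℂ} :
    p ∈ near Z T r ↔ p ∈ Z ∧ p.re ≠ 1 / 2 ∧ ‖p - (1 / 2 + T * I)‖ < r := by simp [near]

lemma mem_far {p : ℂ} :
    p ∈ far Z T r ↔ p ∈ Z ∧ p.re ≠ 1 / 2 ∧ r ≤ ‖p - (1 / 2 + T * I)‖ := by simp [far]

lemma sum_split {E : Type*} [AddCommMonoid E] (Z : Finset ℂ) (T r : ℝ) (f : ℂ → E) :
    ∑ p ∈ Z, f p = ∑ p ∈ onLine Z, f p + (∑ p ∈ near Z T r, f p + ∑ p ∈ far Z T r, f p) := by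
  classical
  have e1 : onLine Z = {p ∈ Z | p.re = 1 / 2} := by ext; simp [mem_onLine]
  have e2 : near Z T r = {p ∈ {p ∈ Z | ¬ p.re = 1 / 2} | ‖p - (1 / 2 + T * I)‖ < r} := by
    ext p; rw [mem_near, Finset.mem_filter, Finset.mem_filter, and_assoc]
  have e3 : far Z T r = {p ∈ {p ∈ Z | ¬ p.re = 1 / 2} | ¬ ‖p - (1 / 2 + T * I)‖ < r} := by
    ext p; rw [mem_far, Finset.mem_filter, Finset.mem_filter, and_assoc, not_lt]
  rw [e1, e2, e3, Finset.sum_filter_add_sum_filter_not, Finset.sum_filter_add_sum_filter_not]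

lemma r_pos (h : LocalData F T N V r r₁ R Z m H) : 0 < r := by
  linarith [h.r₁_pos, h.r₁_le, h.R_le]

lemma R_pos (h : LocalData F T N V r r₁ R Z m H) : 0 < R := by
  linarith [h.r₁_pos, h.r₁_le]

/-- The part of `F'/F` that does not come from the zeros on the line or near `1/2 + iT`. -/
noncomputable def rest (Z : Finset ℂ) (m : ℂ → ℕ) (H : ℂ → ℂ) (T r : ℝ) (s : ℂ) : ℂ :=
  (∑ p ∈ far Z T r, (m p : ℂ) * (1 / (s - p))) + logDeriv H s

lemma diff_F (h : LocalData F T N V r r₁ R Z m H) :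
    DifferentiableOn ℂ F (Metric.ball (1 / 2 + T * I) 1) := by
  have h1 : DifferentiableOn ℂ (fun s => ∏ p ∈ Z, (s - p) ^ m p)
      (Metric.ball (1 / 2 + T * I : ℂ) 1) := Differentiable.differentiableOn (by fun_prop)
  exact (h1.mul h.diff_H).congr h.eq

lemma mem_of_zero (h : LocalData F T N V r r₁ R Z m H) {s : ℂ}
    (hs : s ∈ Metric.ball (1 / 2 + T * I : ℂ) 1) (h0 : F s = 0) : s ∈ Z := by
  rw [h.eq s hs, mul_eq_zero, or_iff_left (h.H_ne_zero s hs), Finset.prod_eq_zero_iff] at h0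
  obtain ⟨p, hp, h0⟩ := h0
  rw [sub_eq_zero.1 (eq_zero_of_pow_eq_zero h0)]
  exact hp

lemma ne_of_ne_zero (h : LocalData F T N V r r₁ R Z m H) {s : ℂ}
    (hs : s ∈ Metric.ball (1 / 2 + T * I : ℂ) 1) (h0 : F s ≠ 0) {p : ℂ} (hp : p ∈ Z) :
    s ≠ p := by
  rintro rfl
  apply h0
  rw [h.eq s hs, Finset.prod_eq_zero hp, zero_mul]
  rw [sub_self, zero_pow (Nat.one_le_iff_ne_zero.1 (h.one_le s hp))]

lemma logDeriv_re (h : LocalData F T N V r r₁ R Z m H) {s : ℂ}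
    (hs : s ∈ Metric.ball (1 / 2 + T * I : ℂ) 1) (h0 : F s ≠ 0) :
    (logDeriv F s).re = ∑ p ∈ onLine Z, (m p : ℝ) * (1 / (s - p)).re +
      ∑ p ∈ near Z T r, (m p : ℝ) * (1 / (s - p)).re + (rest Z m H T r s).re := by
  rw [logDeriv_prod_pow_mul Metric.isOpen_ball h.diff_H h.eq hs h0, sum_split Z T r, rest]
  simp only [add_re, re_sum, ← ofReal_natCast, re_ofReal_mul]
  ring

lemma near_symm (h : LocalData F T N V r r₁ R Z m H) :
    ∀ p ∈ near Z T r, mirror p ∈ near Z T r ∧ m (mirror p) = m p := by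
  intro p hp
  obtain ⟨h1, h2, h3⟩ := mem_near.1 hp
  obtain ⟨-, k2, k3⟩ := h.off_line p h1 h2 h3
  refine ⟨mem_near.2 ⟨k2, ?_, by rwa [norm_mirror_sub]⟩, k3⟩
  rw [mirror_re]
  intro h'
  exact h2 (by linarith)

lemma far_dist {s p : ℂ} (hs : s ∈ Metric.ball (1 / 2 + T * I : ℂ) (r / 2)) (hp : p ∈ far Z T r) :
    r / 2 ≤ ‖s - p‖ := by
  have h1 := (mem_far.1 hp).2.2
  rw [Metric.mem_ball, dist_eq_norm] at hs
  have := norm_sub_norm_le (p - (1 / 2 + T * I)) (s - (1 / 2 + T * I))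
  rw [sub_sub_sub_cancel_right, norm_sub_rev p s] at this
  linarith

lemma ball_sub (h : LocalData F T N V r r₁ R Z m H) :
    Metric.ball (1 / 2 + T * I : ℂ) (r / 2) ⊆ Metric.ball (1 / 2 + T * I : ℂ) (1 / 2) :=
  Metric.ball_subset_ball (by linarith [h.r_le])

lemma ball_sub' : Metric.ball (1 / 2 + T * I : ℂ) (1 / 2) ⊆ Metric.ball (1 / 2 + T * I : ℂ) 1 :=
  Metric.ball_subset_ball (by norm_num)

lemma rest_hasDerivAt (h : LocalData F T N V r r₁ R Z m H) {s : ℂ}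
    (hs : s ∈ Metric.ball (1 / 2 + T * I : ℂ) (r / 2)) :
    HasDerivAt (rest Z m H T r)
      ((∑ p ∈ far Z T r, (m p : ℂ) * (-1 / (s - p) ^ 2)) + deriv (logDeriv H) s) s := by
  have hs1 := ball_sub' (h.ball_sub hs)
  refine HasDerivAt.add (HasDerivAt.fun_sum fun p hp => ?_) ?_
  · refine HasDerivAt.const_mul _ ?_
    have h0 : s - p ≠ 0 := fun h0 => by
      have := far_dist hs hp
      rw [h0, norm_zero] at this
      linarith [h.r_pos]
    have := ((hasDerivAt_id s).sub_const p).fun_inv h0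
    simpa using this
  · refine DifferentiableAt.hasDerivAt ?_
    have ha := h.diff_H.analyticAt (Metric.isOpen_ball.mem_nhds hs1)
    exact ha.deriv.differentiableAt.div ha.differentiableAt (h.H_ne_zero s hs1)

/-- Within r/2 of 1/2 + iT every far zero is at distance at least r/2, so it contributes at most
4m/r² to the derivative. -/
lemma rest_deriv_le (h : LocalData F T N V r r₁ R Z m H) {s : ℂ}
    (hs : s ∈ Metric.ball (1 / 2 + T * I : ℂ) (r / 2)) :
    ‖(∑ p ∈ far Z T r, (m p : ℂ) * (-1 / (s - p) ^ 2)) + deriv (logDeriv H) s‖ ≤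
      4 * N / r ^ 2 + V := by
  refine (norm_add_le _ _).trans (add_le_add ?_ (h.deriv_le s (h.ball_sub hs)))
  have hr := h.r_pos
  calc ‖∑ p ∈ far Z T r, (m p : ℂ) * (-1 / (s - p) ^ 2)‖
      ≤ ∑ p ∈ far Z T r, (m p : ℝ) * (4 / r ^ 2) := by
        refine norm_sum_le_of_le _ fun p hp => ?_
        rw [norm_mul, norm_natCast, norm_div, norm_neg, norm_one, norm_pow]
        have h1 := far_dist hs hp
        rw [show 4 / r ^ 2 = 1 / (r / 2) ^ 2 by field_simp; norm_num]
        gcongr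
    _ ≤ ∑ p ∈ Z, (m p : ℝ) * (4 / r ^ 2) := by
        refine Finset.sum_le_sum_of_subset_of_nonneg (fun p hp => (mem_far.1 hp).1) fun p _ _ => ?_
        positivity
    _ ≤ N * (4 / r ^ 2) := by
        rw [← Finset.sum_mul]
        exact mul_le_mul_of_nonneg_right h.sum_le (by positivity)
    _ = 4 * N / r ^ 2 := by ring

lemma sum_near_line (h : LocalData F T N V r r₁ R Z m H) {s : ℂ} (hs : s.re = 1 / 2) :
    ∑ p ∈ near Z T r, (m p : ℝ) * (1 / (s - p)).re = 0 := by
  have h2 : 2 * ∑ p ∈ near Z T r, (m p : ℝ) * (1 / (s - p)).re = 0 := by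
    rw [sum_re_symm h.near_symm]
    refine Finset.sum_eq_zero fun p hp => ?_
    have hp' := (mem_near.1 hp).2.1
    rw [re_one_div_pair_eq_zero _ _ hs, mul_zero]
    · rintro rfl; exact hp' hs
    · rintro rfl; rw [mirror_re] at hs; exact hp' (by linarith)
  linarith

/-- On the line the zeros of the line contribute real part zero and the near pairs cancel, so only
`rest` remains in Re F'/F. The bound extends by continuity to the finitely many zeros on the line,
where `rest` is regular. -/
lemma rest_line (h : LocalData F T N V r r₁ R Z m H) {s : ℂ}
    (hs : s ∈ Metric.ball (1 / 2 + T * I : ℂ) (r / 2)) (hline : s.re = 1 / 2) :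
    (rest Z m H T r s).re ≤ -1 := by
  have hgen : ∀ s ∈ Metric.ball (1 / 2 + T * I : ℂ) (r / 2), s.re = 1 / 2 → F s ≠ 0 →
      (rest Z m H T r s).re ≤ -1 := by
    intro s hs hline h0
    have h1 := h.line s (h.ball_sub hs) hline h0
    rw [h.logDeriv_re (ball_sub' (h.ball_sub hs)) h0, h.sum_near_line hline,
      Finset.sum_eq_zero, zero_add, zero_add] at h1
    · exact h1
    · intro p hp
      rw [re_one_div, sub_re, hline, (mem_onLine.1 hp).2, sub_self, zero_div, mul_zero]
  have hγ : ContinuousAt (fun t : ℝ => (1 / 2 + t * I : ℂ)) s.im := by fun_prop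
  have hγs : (1 / 2 + s.im * I : ℂ) = s := by apply Complex.ext <;> simp [hline]
  have hcont : Filter.Tendsto (fun t : ℝ => (rest Z m H T r (1 / 2 + t * I)).re)
      (nhdsWithin s.im {s.im}ᶜ) (nhds (rest Z m H T r s).re) := by
    have h1 : ContinuousAt (rest Z m H T r) (1 / 2 + s.im * I) := by
      rw [hγs]; exact (h.rest_hasDerivAt hs).continuousAt
    have h2 : ContinuousAt (fun t : ℝ => (rest Z m H T r (1 / 2 + t * I)).re) s.im :=
      continuous_re.continuousAt.comp (h1.comp (f := fun t : ℝ => (1 / 2 + t * I : ℂ)) hγ)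
    have h3 := h2.tendsto
    rw [hγs] at h3
    exact h3.mono_left nhdsWithin_le_nhds
  refine le_of_tendsto hcont ?_
  have hball : ∀ᶠ t : ℝ in nhdsWithin s.im {s.im}ᶜ,
      (1 / 2 + t * I : ℂ) ∈ Metric.ball (1 / 2 + T * I : ℂ) (r / 2) :=
    (hγ.eventually_mem (Metric.isOpen_ball.mem_nhds (by rwa [hγs]))).filter_mono nhdsWithin_le_nhds
  have hfin : ∀ᶠ t : ℝ in nhdsWithin s.im {s.im}ᶜ, t ∉ (Z.image Complex.im : Finset ℝ) := by
    have h1 : ((Z.image Complex.im : Finset ℝ) : Set ℝ) \ {s.im} |>.Finite :=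
      (Finset.finite_toSet _).subset Set.sdiff_subset
    have h2 := h1.isClosed.isOpen_compl.mem_nhds (x := s.im) (by simp)
    filter_upwards [mem_nhdsWithin_of_mem_nhds h2, self_mem_nhdsWithin] with t ht ht' hmem
    exact ht ⟨hmem, ht'⟩
  filter_upwards [hball, hfin] with t ht hmem
  refine hgen _ ht (by simp) fun h0 => hmem ?_
  exact Finset.mem_image.2 ⟨_, h.mem_of_zero (ball_sub' (h.ball_sub ht)) h0, by simp⟩

lemma proj_dist {s : ℂ} : ‖(1 / 2 + s.im * I : ℂ) - (1 / 2 + T * I)‖ ≤ ‖s - (1 / 2 + T * I)‖ := by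
  have : (1 / 2 + s.im * I : ℂ) - (1 / 2 + T * I) = ((s - (1 / 2 + T * I)).im : ℝ) * I := by
    apply Complex.ext <;> simp
  rw [this, norm_mul, norm_I, mul_one, norm_real]
  exact abs_im_le_norm _

lemma norm_sub_proj {s : ℂ} : ‖s - (1 / 2 + s.im * I)‖ = |s.re - 1 / 2| := by
  have : s - (1 / 2 + s.im * I) = ((s.re - 1 / 2 : ℝ) : ℂ) := by
    apply Complex.ext <;> simp
  rw [this, norm_real, Real.norm_eq_abs]

lemma abs_re_sub_le {s : ℂ} : |s.re - 1 / 2| ≤ ‖s - (1 / 2 + T * I)‖ := by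
  have := abs_re_le_norm (s - (1 / 2 + T * I))
  simpa using this

/-- Comparison with the horizontal projection of `s` to the line, where the value is at most -1; by
the mean value inequality and `small` the change is at most 1/2. -/
lemma rest_re_le (h : LocalData F T N V r r₁ R Z m H) {s : ℂ}
    (hs : s ∈ Metric.ball (1 / 2 + T * I : ℂ) (2 * R)) : (rest Z m H T r s).re ≤ -(1 / 2) := by
  have hsub : Metric.ball (1 / 2 + T * I : ℂ) (2 * R) ⊆ Metric.ball (1 / 2 + T * I : ℂ) (r / 2) :=
    Metric.ball_subset_ball (by linarith [h.R_le])
  have hs' : (1 / 2 + s.im * I : ℂ) ∈ Metric.ball (1 / 2 + T * I : ℂ) (r / 2) := by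
    refine hsub ?_
    rw [Metric.mem_ball, dist_eq_norm] at hs ⊢
    exact proj_dist.trans_lt hs
  have h1 := (convex_ball (1 / 2 + T * I : ℂ) (r / 2)).norm_image_sub_le_of_norm_hasDerivWithin_le
    (fun z hz => (h.rest_hasDerivAt hz).hasDerivWithinAt) (fun z hz => h.rest_deriv_le hz) hs'
    (hsub hs)
  rw [norm_sub_proj] at h1
  have h2 := h.rest_line hs' (by simp)
  have h3 := (re_le_norm _).trans h1
  rw [sub_re] at h3
  rw [Metric.mem_ball, dist_eq_norm] at hs
  have h4 := abs_re_sub_le.trans hs.le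
  have h5 : 0 ≤ 4 * N / r ^ 2 + V := (norm_nonneg _).trans (h.rest_deriv_le (hsub (by
    rw [Metric.mem_ball, dist_eq_norm]; exact hs)))
  have h6 := (mul_le_mul_of_nonneg_left h4 h5).trans h.small
  linarith

lemma sum_onLine_nonpos {s : ℂ} (hs : s.re ≤ 1 / 2) :
    ∑ p ∈ onLine Z, (m p : ℝ) * (1 / (s - p)).re ≤ 0 := by
  refine Finset.sum_nonpos fun p hp => mul_nonpos_of_nonneg_of_nonpos (by positivity) ?_
  rw [re_one_div, sub_re, (mem_onLine.1 hp).2]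
  exact div_nonpos_of_nonpos_of_nonneg (by linarith) (normSq_nonneg _)

lemma not_zero_of_dist (h : LocalData F T N V r r₁ R Z m H) {s : ℂ}
    (hs : s ∈ Metric.ball (1 / 2 + T * I : ℂ) (2 * R)) (hre : s.re < 1 / 2)
    (hd : 2 * r₁ ≤ ‖s - (1 / 2 + T * I)‖) : F s ≠ 0 := by
  intro h0
  have hR := h.R_le
  have hRp := h.R_pos
  rw [Metric.mem_ball, dist_eq_norm] at hs
  have hZ := h.mem_of_zero (s := s) (by
    rw [Metric.mem_ball, dist_eq_norm]; linarith [h.r_le]) h0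
  have := (h.off_line s hZ hre.ne (by linarith)).1
  linarith [h.r₁_pos]

lemma mem_ball_one (h : LocalData F T N V r r₁ R Z m H) {s : ℂ}
    (hs : s ∈ Metric.ball (1 / 2 + T * I : ℂ) (2 * R)) :
    s ∈ Metric.ball (1 / 2 + T * I : ℂ) 1 :=
  Metric.ball_subset_ball (by linarith [h.r_le, h.R_le, h.R_pos]) hs

/-- Near zeros lie within r₁ of 1/2 + iT. A point at distance at least 2r₁ is thus at distance at
least r₁ from the midpoint of each near pair, hence outside the disc of that pair, whose
contribution is nonpositive. The strict sign comes from `rest`. -/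
lemma logDeriv_re_neg_of_dist (h : LocalData F T N V r r₁ R Z m H) {s : ℂ}
    (hs : s ∈ Metric.ball (1 / 2 + T * I : ℂ) (2 * R)) (hre : s.re < 1 / 2)
    (hd : 2 * r₁ ≤ ‖s - (1 / 2 + T * I)‖) : (logDeriv F s).re < 0 := by
  have h0 := h.not_zero_of_dist hs hre hd
  rw [h.logDeriv_re (h.mem_ball_one hs) h0]
  have h1 : ∑ p ∈ onLine Z, (m p : ℝ) * (1 / (s - p)).re ≤ 0 := sum_onLine_nonpos hre.le
  have h2 := h.rest_re_le hs
  have h3 : 2 * ∑ p ∈ near Z T r, (m p : ℝ) * (1 / (s - p)).re ≤ 0 := by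
    rw [sum_re_symm h.near_symm]
    refine Finset.sum_nonpos fun p hp => mul_nonpos_of_nonneg_of_nonpos (by positivity) ?_
    have hp' := mem_near.1 hp
    refine re_one_div_pair_nonpos (h.ne_of_ne_zero (h.mem_ball_one hs) h0 hp'.1)
      (h.ne_of_ne_zero (h.mem_ball_one hs) h0 (mem_near.1 (h.near_symm p hp).1).1) hre.le ?_
    have k1 := (h.off_line p hp'.1 hp'.2.1 hp'.2.2).1
    have e1 : ‖p - (1 / 2 + T * I)‖ ^ 2 = (p.re - 1 / 2) ^ 2 + (p.im - T) ^ 2 := by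
      rw [Complex.sq_norm, normSq_apply]; simp; ring
    have e2 : ‖s - (1 / 2 + p.im * I)‖ ^ 2 = (s.re - 1 / 2) ^ 2 + (s.im - p.im) ^ 2 := by
      rw [Complex.sq_norm, normSq_apply]; simp; ring
    have e3 : ‖s - (1 / 2 + T * I)‖ ≤
        ‖s - (1 / 2 + p.im * I)‖ + ‖(1 / 2 + p.im * I : ℂ) - (1 / 2 + T * I)‖ := by
      have := norm_add_le (s - (1 / 2 + p.im * I)) ((1 / 2 + p.im * I : ℂ) - (1 / 2 + T * I))
      rwa [sub_add_sub_cancel] at this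
    have e4 := proj_dist (T := T) (s := p)
    have e5 : ‖p - (1 / 2 + T * I)‖ ^ 2 ≤ r₁ ^ 2 := by gcongr
    have e6 : r₁ ^ 2 ≤ ‖s - (1 / 2 + p.im * I)‖ ^ 2 :=
      pow_le_pow_left₀ h.r₁_pos.le (by linarith) 2
    nlinarith [sq_nonneg (p.im - T)]
  linarith

/-- Close to the line even the inner pairs do no harm: their total vanishes on the line and is
continuous, because they keep a positive distance β from it. The width η may depend on F, as it does
not enter the final radius. -/
lemma exists_strip (h : LocalData F T N V r r₁ R Z m H) :
    ∃ η : ℝ, 0 < η ∧ 4 * η ≤ R ∧ ∀ s ∈ Metric.ball (1 / 2 + T * I : ℂ) (2 * R),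
      1 / 2 - η ≤ s.re → s.re < 1 / 2 → F s ≠ 0 ∧ (logDeriv F s).re < 0 := by
  obtain ⟨β, hβ, hβZ⟩ := exists_pos_le_abs (Z := near Z T r) fun p hp => (mem_near.1 hp).2.1
  have hR := h.R_pos
  have hN : 0 ≤ N := (Finset.sum_nonneg fun p _ => by positivity).trans h.sum_le
  -- η ≤ β/2 keeps the strip at distance β/2 from the near zeros; the last bound makes their total
  -- at most 2Nη/β² ≤ 1/4, below the 1/2 gained from `rest`.
  set η : ℝ := min (R / 4) (min (β / 2) (β ^ 2 / (8 * (N + 1)))) with hη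
  have hη0 : 0 < η := by positivity
  have hη1 : η ≤ R / 4 := min_le_left _ _
  have hη2 : η ≤ β / 2 := (min_le_right _ _).trans (min_le_left _ _)
  have hη3 : η ≤ β ^ 2 / (8 * (N + 1)) := (min_le_right _ _).trans (min_le_right _ _)
  refine ⟨η, hη0, by linarith, fun s hs h1 h2 => ?_⟩
  have hx : |s.re - 1 / 2| ≤ η := by rw [abs_le]; constructor <;> linarith
  have hs1 := h.mem_ball_one hs
  have hF : F s ≠ 0 := by
    intro h0
    have hZ := h.mem_of_zero hs1 h0
    have hR' := h.R_le
    rw [Metric.mem_ball, dist_eq_norm] at hs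
    have := hβZ s (mem_near.2 ⟨hZ, h2.ne, by linarith⟩)
    linarith
  refine ⟨hF, ?_⟩
  rw [h.logDeriv_re hs1 hF]
  have k1 : ∑ p ∈ onLine Z, (m p : ℝ) * (1 / (s - p)).re ≤ 0 := sum_onLine_nonpos h2.le
  have k2 := h.rest_re_le hs
  have k3 : ∑ p ∈ near Z T r, (m p : ℝ) * (1 / (s - p)).re ≤ 1 / 4 := by
    have hl := h.sum_near_line (s := 1 / 2 + s.im * I) (by simp)
    calc ∑ p ∈ near Z T r, (m p : ℝ) * (1 / (s - p)).re
        = ∑ p ∈ near Z T r, (m p : ℝ) *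
            (1 / (s - p) - 1 / ((1 / 2 + s.im * I : ℂ) - p)).re := by
          rw [← sub_zero (∑ p ∈ near Z T r, (m p : ℝ) * (1 / (s - p)).re), ← hl,
            ← Finset.sum_sub_distrib]
          exact Finset.sum_congr rfl fun p _ => by rw [sub_re, mul_sub]
      _ ≤ ∑ p ∈ near Z T r, (m p : ℝ) * (2 * η / β ^ 2) := by
          refine Finset.sum_le_sum fun p hp => mul_le_mul_of_nonneg_left ?_ (by positivity)
          refine (re_le_norm _).trans ?_
          have hp1 : β ≤ ‖(1 / 2 + s.im * I : ℂ) - p‖ := by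
            refine (hβZ p hp).trans ?_
            have := abs_re_le_norm ((1 / 2 + s.im * I : ℂ) - p)
            rw [abs_sub_comm]
            simpa using this
          have hp2 : β / 2 ≤ ‖s - p‖ := by
            have := norm_sub_norm_le ((1 / 2 + s.im * I : ℂ) - p) ((1 / 2 + s.im * I : ℂ) - s)
            rw [sub_sub_sub_cancel_left, norm_sub_rev _ s, norm_sub_proj] at this
            linarith
          have n1 : (1 / 2 + s.im * I : ℂ) - p ≠ 0 := norm_pos_iff.1 (hβ.trans_le hp1)
          have n2 : s - p ≠ 0 := norm_pos_iff.1 ((half_pos hβ).trans_le hp2)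
          rw [div_sub_div _ _ n2 n1, one_mul, mul_one, sub_sub_sub_cancel_right, norm_div, norm_mul,
            norm_sub_rev, norm_sub_proj, show 2 * η / β ^ 2 = η / (β / 2 * β) by field_simp]
          gcongr
      _ ≤ ∑ p ∈ Z, (m p : ℝ) * (2 * η / β ^ 2) :=
          Finset.sum_le_sum_of_subset_of_nonneg (fun p hp => (mem_near.1 hp).1) fun p _ _ => by
            positivity
      _ ≤ N * (2 * η / β ^ 2) := by
          rw [← Finset.sum_mul]
          exact mul_le_mul_of_nonneg_right h.sum_le (by positivity)
      _ ≤ 1 / 4 := by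
          rw [le_div_iff₀ (by positivity)] at hη3
          rw [← mul_div_assoc, div_le_iff₀ (by positivity)]
          nlinarith
  linarith

theorem zeroCount_eq (h : LocalData F T N V r r₁ R Z m H) {σ₀ : ℝ} (h1 : 1 / 2 - r₁ ≤ σ₀)
    (h2 : σ₀ ≤ 1 / 2) :
    ∃ n : ℕ,
      zeroCount F {s : ℂ | ‖s - ((σ₀ : ℂ) + T * I)‖ ≤ R ∧ s.re < 1 / 2} = n ∧
      zeroCount (deriv F) {s : ℂ | ‖s - ((σ₀ : ℂ) + T * I)‖ ≤ R ∧ s.re < 1 / 2} = n := by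
  obtain ⟨η, hη, hηR, hstrip⟩ := h.exists_strip
  have hR := h.R_pos
  have hr₁ := h.r₁_pos
  have hr₁R := h.r₁_le
  set D : Set ℂ := {s : ℂ | ‖s - ((σ₀ : ℂ) + T * I)‖ ≤ R ∧ s.re < 1 / 2} with hD
  have hc : ‖((σ₀ : ℂ) + T * I) - (1 / 2 + T * I)‖ ≤ r₁ := by
    have : ((σ₀ : ℂ) + T * I) - (1 / 2 + T * I) = ((σ₀ - 1 / 2 : ℝ) : ℂ) := by push_cast; ring
    rw [this, norm_real, Real.norm_eq_abs, abs_le]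
    constructor <;> linarith
  have hDb : ∀ s ∈ D, s ∈ Metric.ball (1 / 2 + T * I : ℂ) (2 * R) := by
    intro s hs
    rw [Metric.mem_ball, dist_eq_norm]
    have := norm_add_le (s - ((σ₀ : ℂ) + T * I)) (((σ₀ : ℂ) + T * I) - (1 / 2 + T * I))
    rw [sub_add_sub_cancel] at this
    linarith [hs.1]
  -- The right side lies in the strip and the other three at distance R/2 ≥ 2r₁ from 1/2 + iT. The
  -- corners are within 3R/4 of that point, so K fits into the disc around the shifted centre.
  set K := closedRect (1 / 2 - R / 2) (1 / 2 - η) (T - R / 2) (T + R / 2) with hK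
  have hKn : ∀ s ∈ K, ‖s - (1 / 2 + T * I)‖ ≤ 3 / 4 * R := by
    rintro s ⟨k1, k2, k3, k4⟩
    refine abs_le_of_sq_le_sq' ?_ (by positivity) |>.2
    rw [Complex.sq_norm, normSq_apply]
    simp
    nlinarith
  have hKD : K ⊆ D := by
    intro s hs
    refine ⟨?_, by linarith [hs.2.1]⟩
    have := norm_sub_le (s - (1 / 2 + T * I)) (((σ₀ : ℂ) + T * I) - (1 / 2 + T * I))
    rw [sub_sub_sub_cancel_right] at this
    linarith [hKn s hs]
  have hneg : ∀ s ∈ D, s ∉ K → F s ≠ 0 ∧ (logDeriv F s).re < 0 := by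
    intro s hs hsK
    have hsb := hDb s hs
    by_cases hx : 1 / 2 - η ≤ s.re
    · exact hstrip s hsb hx hs.2
    · have hd : 2 * r₁ ≤ ‖s - (1 / 2 + T * I)‖ := by
        by_contra hlt
        apply hsK
        have a1 := abs_re_le_norm (s - (1 / 2 + T * I))
        have a2 := abs_im_le_norm (s - (1 / 2 + T * I))
        simp only [sub_re, add_re, one_div, sub_im, add_im] at a1 a2
        simp at a1 a2
        rw [abs_le] at a1 a2
        push Not at hlt hx
        simp at hlt
        refine ⟨?_, hx.le, ?_, ?_⟩ <;> linarith [a1.1, a1.2, a2.1, a2.2]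
      exact ⟨h.not_zero_of_dist hsb hs.2 hd, h.logDeriv_re_neg_of_dist hsb hs.2 hd⟩
  have hbd : ∀ s ∈ rectBoundary (1 / 2 - R / 2) (1 / 2 - η) (T - R / 2) (T + R / 2),
      (deriv F s / F s).re < 0 := by
    rintro s ⟨hsK, hs⟩
    have hsD := hKD hsK
    have hsb := hDb s hsD
    change (logDeriv F s).re < 0
    by_cases hx : 1 / 2 - η ≤ s.re
    · exact (hstrip s hsb hx hsD.2).2
    · refine h.logDeriv_re_neg_of_dist hsb hsD.2 ?_
      have a1 := abs_re_le_norm (s - (1 / 2 + T * I))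
      have a2 := abs_im_le_norm (s - (1 / 2 + T * I))
      have b1 : (s - (1 / 2 + T * I)).re = s.re - 1 / 2 := by simp
      have b2 : (s - (1 / 2 + T * I)).im = s.im - T := by simp
      rw [b1] at a1
      rw [b2] at a2
      rw [abs_le] at a1 a2
      rcases hs with hs | hs | hs | hs
      · linarith [a1.1]
      · exact absurd hs.ge hx
      · linarith [a2.1]
      · linarith [a2.2]
  have hKU : K ⊆ Metric.ball (1 / 2 + T * I : ℂ) 1 := fun s hs => h.mem_ball_one (hDb s (hKD hs))
  obtain ⟨n, hn1, hn2⟩ := zeroCount_closedRect_eq Metric.isOpen_ball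
    (h.diff_F.deriv Metric.isOpen_ball) h.diff_F (by linarith) (by linarith) hKU hbd
  have han : ∀ s ∈ D, AnalyticAt ℂ F s := fun s hs =>
    h.diff_F.analyticAt (Metric.isOpen_ball.mem_nhds (h.mem_ball_one (hDb s hs)))
  refine ⟨n, ?_, ?_⟩
  · rw [zeroCount_congr_set hKD fun s hs hsK => zeroMult_eq_zero (han s hs) (hneg s hs hsK).1]
    exact hn2
  · rw [zeroCount_congr_set hKD fun s hs hsK => zeroMult_eq_zero (han s hs).deriv fun h0 => ?_]
    · exact hn1
    · have := (hneg s hs hsK).2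
      rw [logDeriv_apply, h0] at this
      simp at this

end LocalData

/-! ### A lower bound for the real part of the digamma function. -/

section digamma

/-- Expand |z + h|², use h² ≤ h and 1 + x ≤ exp x. The bound is linear in h in the exponent, as
needed for differentiation at h = 0. -/
lemma norm_add_le_norm_mul_exp {z : ℂ} (hz : 0 < z.re) {h : ℝ} (h0 : 0 ≤ h) (h1 : h ≤ 1) :
    ‖z + h‖ ≤ ‖z‖ * Real.exp (h * ((z.re + 1 / 2) / ‖z‖ ^ 2)) := by
  have hz0 : 0 < ‖z‖ := norm_pos_iff.2 fun h' => by simp [h'] at hz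
  refine abs_le_of_sq_le_sq' ?_ (by positivity) |>.2
  rw [mul_pow, ← Real.exp_nat_mul]
  have e1 : ‖z + h‖ ^ 2 = ‖z‖ ^ 2 + 2 * h * z.re + h ^ 2 := by
    rw [Complex.sq_norm, Complex.sq_norm, normSq_apply, normSq_apply]
    simp
    ring
  have e2 := Real.add_one_le_exp ((2 : ℕ) * (h * ((z.re + 1 / 2) / ‖z‖ ^ 2)))
  calc ‖z + h‖ ^ 2 ≤ ‖z‖ ^ 2 * ((2 : ℕ) * (h * ((z.re + 1 / 2) / ‖z‖ ^ 2)) + 1) := by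
        rw [e1]
        field_simp
        push_cast
        nlinarith
    _ ≤ _ := by gcongr

lemma weight_le_inv {u t : ℝ} (hu : 0 < u) (ht : 1 ≤ t) :
    (u + 1 / 2) / (u ^ 2 + t ^ 2) ≤ 1 / t := by
  rw [div_le_div_iff₀ (by positivity) (by positivity)]
  nlinarith [sq_nonneg (u - t)]

/-- Compare log(1 + 1/n) ≥ 1/(n + 1/2) with (u + 1/2)(n + 1/2) ≤ (u + 1/2)(u - 1/2) < u². -/
lemma weight_le_log {u t : ℝ} {n : ℕ} (hn : 1 ≤ n) (hu : (n : ℝ) + 1 ≤ u) :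
    (u + 1 / 2) / (u ^ 2 + t ^ 2) ≤ Real.log (n + 1 : ℕ) - Real.log n := by
  have hn' : (1 : ℝ) ≤ n := by exact_mod_cast hn
  have h1 := Real.le_log_one_add_of_nonneg (x := 1 / n) (by positivity)
  have h2 : Real.log (n + 1 : ℕ) - Real.log n = Real.log (1 + 1 / n) := by
    rw [← Real.log_div (by positivity) (by positivity)]
    congr 1
    push_cast
    field_simp
  rw [h2]
  have hu0 : 0 < u := by linarith
  refine le_trans ?_ h1
  have h3 : 2 * (1 / (n : ℝ)) / (1 / n + 2) = 1 / (n + 1 / 2) := by field_simp; ring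
  rw [h3, div_le_div_iff₀ (by positivity) (by positivity)]
  nlinarith [sq_nonneg t]

/-- The first m + 1 terms are bounded by 1/t each, the others by a telescoping sum of logarithms.
With m of size t this is log n - log t up to a constant. -/
lemma sum_weight_le {σ t : ℝ} (hσ : 0 < σ) (ht : 1 ≤ t) {m n : ℕ} (hm : 1 ≤ m) (hmn : m ≤ n) :
    ∑ j ∈ Finset.range (n + 1), (σ + j + 1 / 2) / ((σ + j) ^ 2 + t ^ 2) ≤
      (m + 1) / t + Real.log n - Real.log m := by
  induction n, hmn using Nat.le_induction with
  | base =>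
    rw [add_sub_cancel_right]
    calc _ ≤ ∑ j ∈ Finset.range (m + 1), 1 / t :=
          Finset.sum_le_sum fun j _ => weight_le_inv (by positivity) ht
      _ = (m + 1) / t := by simp; ring
  | succ n hn ih =>
    rw [Finset.sum_range_succ]
    have := weight_le_log (u := σ + (n + 1 : ℕ)) (t := t) (hm.trans hn) (by push_cast; linarith)
    linarith

/-- In Gauss's product the numerator gains n^h, while the denominator grows by at most exp(h(3 + log
n - log t)); the terms log n cancel, leaving a bound that survives the limit. -/
lemma norm_GammaSeq_add_ge {s : ℂ} (hs : 0 < s.re) (ht : 1 ≤ s.im) {h : ℝ} (h0 : 0 ≤ h)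
    (h1 : h ≤ 1) {n : ℕ} (hn : ⌈s.im⌉₊ ≤ n) :
    ‖GammaSeq s n‖ * Real.exp (h * (Real.log s.im - 3)) ≤ ‖GammaSeq (s + h) n‖ := by
  set t := s.im with htdef
  have hm : 1 ≤ ⌈t⌉₊ := Nat.one_le_ceil_iff.2 (by linarith)
  have hn0 : 0 < (n : ℝ) := by exact_mod_cast (hm.trans hn)
  have hmt : t ≤ (⌈t⌉₊ : ℝ) := Nat.le_ceil t
  have hmt' : (⌈t⌉₊ : ℝ) < t + 1 := Nat.ceil_lt_add_one (by linarith)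
  have hsum := sum_weight_le hs ht hm hn
  have hsum' : ∑ j ∈ Finset.range (n + 1), (s.re + j + 1 / 2) / ((s.re + j) ^ 2 + t ^ 2) ≤
      3 + Real.log n - Real.log t := by
    have a1 : ((⌈t⌉₊ : ℝ) + 1) / t ≤ 3 := by
      rw [div_le_iff₀ (by linarith)]; linarith
    have a2 := Real.log_le_log (by linarith) hmt
    linarith
  have hnorm : ∀ z : ℂ, ‖GammaSeq z n‖ =
      (n : ℝ) ^ z.re * (n.factorial : ℝ) / ∏ j ∈ Finset.range (n + 1), ‖z + j‖ := by
    intro z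
    rw [GammaSeq, norm_div, norm_mul, norm_prod, norm_natCast, ← ofReal_natCast,
      norm_cpow_eq_rpow_re_of_pos hn0]
  have hpos : ∀ j : ℕ, 0 < ‖s + j‖ := fun j => norm_pos_iff.2 fun h' => by
    have := congrArg Complex.re h'
    simp at this
    linarith [(Nat.cast_nonneg j : (0 : ℝ) ≤ j)]
  have hpos' : ∀ j : ℕ, 0 < ‖s + h + j‖ := fun j => norm_pos_iff.2 fun h' => by
    have := congrArg Complex.re h'
    simp at this
    linarith [(Nat.cast_nonneg j : (0 : ℝ) ≤ j)]
  have hprod : ∏ j ∈ Finset.range (n + 1), ‖s + h + j‖ ≤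
      (∏ j ∈ Finset.range (n + 1), ‖s + j‖) *
        Real.exp (h * (3 + Real.log n - Real.log t)) := by
    calc ∏ j ∈ Finset.range (n + 1), ‖s + h + j‖
        ≤ ∏ j ∈ Finset.range (n + 1), (‖s + j‖ *
            Real.exp (h * ((s.re + j + 1 / 2) / ((s.re + j) ^ 2 + t ^ 2)))) := by
          refine Finset.prod_le_prod (fun j _ => (hpos' j).le) fun j _ => ?_
          have := norm_add_le_norm_mul_exp (z := s + j) (by simp; positivity) h0 h1
          have e : ‖s + j‖ ^ 2 = (s.re + j) ^ 2 + t ^ 2 := by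
            rw [Complex.sq_norm, normSq_apply]
            simp [htdef]
            ring
          rw [e] at this
          simpa [add_right_comm] using this
      _ = (∏ j ∈ Finset.range (n + 1), ‖s + j‖) * Real.exp (h * ∑ j ∈ Finset.range (n + 1),
            (s.re + j + 1 / 2) / ((s.re + j) ^ 2 + t ^ 2)) := by
          rw [Finset.prod_mul_distrib, ← Real.exp_sum, Finset.mul_sum]
      _ ≤ _ := by
          have : 0 ≤ ∏ j ∈ Finset.range (n + 1), ‖s + j‖ := Finset.prod_nonneg fun j _ => (hpos j).le
          gcongr
  have hP : 0 < ∏ j ∈ Finset.range (n + 1), ‖s + j‖ := Finset.prod_pos fun j _ => hpos j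
  have hP' : 0 < ∏ j ∈ Finset.range (n + 1), ‖s + h + j‖ := Finset.prod_pos fun j _ => hpos' j
  rw [hnorm, hnorm, add_re, ofReal_re, Real.rpow_add hn0, div_mul_eq_mul_div,
    div_le_div_iff₀ hP hP']
  have e1 : (n : ℝ) ^ h = Real.exp (h * Real.log n) := by
    rw [Real.rpow_def_of_pos hn0, mul_comm]
  have e2 : Real.exp (h * (Real.log t - 3)) * Real.exp (h * (3 + Real.log n - Real.log t)) =
      (n : ℝ) ^ h := by
    rw [e1, ← Real.exp_add]; congr 1; ring
  calc (n : ℝ) ^ s.re * n.factorial * Real.exp (h * (Real.log t - 3)) *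
        ∏ j ∈ Finset.range (n + 1), ‖s + h + j‖
      ≤ (n : ℝ) ^ s.re * n.factorial * Real.exp (h * (Real.log t - 3)) *
        ((∏ j ∈ Finset.range (n + 1), ‖s + j‖) *
          Real.exp (h * (3 + Real.log n - Real.log t))) := by gcongr
    _ = _ := by rw [← e2]; ring

lemma norm_Gamma_add_ge {s : ℂ} (hs : 0 < s.re) (ht : 1 ≤ s.im) {h : ℝ} (h0 : 0 ≤ h)
    (h1 : h ≤ 1) : ‖Gamma s‖ * Real.exp (h * (Real.log s.im - 3)) ≤ ‖Gamma (s + h)‖ := by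
  refine le_of_tendsto_of_tendsto ((GammaSeq_tendsto_Gamma s).norm.mul_const _)
    (GammaSeq_tendsto_Gamma (s + h)).norm ?_
  filter_upwards [Filter.eventually_ge_atTop ⌈s.im⌉₊] with n hn
    using norm_GammaSeq_add_ge hs ht h0 h1 hn

/-- The real part of the digamma function tends to infinity along vertical lines. -/
theorem log_im_sub_le_digamma_re {s : ℂ} (hs : 0 < s.re) (ht : 1 ≤ s.im) :
    Real.log s.im - 3 ≤ (digamma s).re := by
  set M := Real.log s.im - 3 with hM
  have hG0 : Gamma s ≠ 0 := Gamma_ne_zero_of_re_pos hs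
  have hd : HasDerivAt Gamma (deriv Gamma s) s :=
    (differentiableAt_Gamma s fun m h => by
      have := congrArg Complex.re h
      simp at this
      linarith [(Nat.cast_nonneg m : (0 : ℝ) ≤ m)]).hasDerivAt
  have h1 : HasDerivAt (fun h : ℝ => Gamma (s + h)) (deriv Gamma s) 0 := by
    have h2 : HasDerivAt (fun h : ℂ => Gamma (s + h)) (deriv Gamma s) ((0 : ℝ) : ℂ) := by
      have := HasDerivAt.comp_const_add s ((0 : ℝ) : ℂ) (f := Gamma) (f' := deriv Gamma s)
        (by simpa using hd)
      exact this
    exact h2.comp_ofReal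
  have h2 := h1.norm_sq
  have h3 : HasDerivAt (fun h : ℝ => ‖Gamma s‖ ^ 2 * Real.exp (h * (2 * M)))
      (‖Gamma s‖ ^ 2 * (2 * M)) 0 := by
    have := (((hasDerivAt_id (0 : ℝ)).mul_const (2 * M)).exp).const_mul (‖Gamma s‖ ^ 2)
    simpa using this
  have h4 := (h2.sub h3).tendsto_slope_zero_right
  -- The difference of the two sides of the squared inequality vanishes at h = 0 and is nonnegative
  -- on (0, 1], so its right derivative at 0 is nonnegative.
  have h5 : 0 ≤ 2 * inner ℝ (Gamma (s + (0 : ℝ))) (deriv Gamma s) - ‖Gamma s‖ ^ 2 * (2 * M) := by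
    refine ge_of_tendsto h4 ?_
    filter_upwards [Ioc_mem_nhdsGT (zero_lt_one' ℝ)] with h hh
    have k := norm_Gamma_add_ge hs ht hh.1.le hh.2
    have k2 := pow_le_pow_left₀ (by positivity) k 2
    rw [mul_pow, ← Real.exp_nat_mul] at k2
    have k3 : ((2 : ℕ) : ℝ) * (h * (Real.log s.im - 3)) = h * (2 * M) := by push_cast; ring
    rw [k3] at k2
    simp only [zero_add, Pi.sub_apply, ofReal_zero, add_zero, zero_mul, Real.exp_zero, mul_one,
      sub_self, sub_zero, smul_eq_mul]
    have := hh.1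
    have k4 : 0 ≤ ‖Gamma (s + h)‖ ^ 2 - ‖Gamma s‖ ^ 2 * Real.exp (h * (2 * M)) := by linarith
    positivity
  have hn : 0 < ‖Gamma s‖ ^ 2 := by positivity
  have h6 : (digamma s).re * ‖Gamma s‖ ^ 2 = inner ℝ (Gamma s) (deriv Gamma s) := by
    rw [digamma_def, logDeriv_apply, Complex.inner, div_re, Complex.sq_norm]
    have : normSq (Gamma s) ≠ 0 := by simpa using hG0
    field_simp
    simp
  rw [ofReal_zero, add_zero, ← h6] at h5
  nlinarith

end digamma

/-! ### Reflection of holomorphic functions. -/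

section reflection

/-- The reflection `s ↦ conj (f (1 - conj s))` of a function in the line `σ = 1/2`. -/
noncomputable def reflect (f : ℂ → ℂ) (s : ℂ) : ℂ := starRingEnd ℂ (f (mirror s))

lemma hasDerivAt_reflect {f : ℂ → ℂ} {s f' : ℂ} (hf : HasDerivAt f f' (mirror s)) :
    HasDerivAt (reflect f) (-starRingEnd ℂ f') s := by
  have h1 : HasDerivAt f f' (starRingEnd ℂ (1 - s)) := by simpa [mirror] using hf
  have h2 := h1.conj_conj
  rw [Complex.conj_conj] at h2
  have h3 := h2.comp_const_sub 1 s
  refine h3.congr_of_eventuallyEq (Filter.Eventually.of_forall fun z => ?_)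
  simp [reflect, mirror]

lemma differentiableAt_reflect {f : ℂ → ℂ} {s : ℂ} (hf : DifferentiableAt ℂ f (mirror s)) :
    DifferentiableAt ℂ (reflect f) s :=
  (hasDerivAt_reflect hf.hasDerivAt).differentiableAt

lemma continuous_mirror : Continuous mirror := by
  unfold mirror
  fun_prop

lemma analyticAt_reflect {f : ℂ → ℂ} {s : ℂ} (hf : AnalyticAt ℂ f (mirror s)) :
    AnalyticAt ℂ (reflect f) s := by
  rw [analyticAt_iff_eventually_differentiableAt] at hf ⊢
  filter_upwards [continuous_mirror.continuousAt.eventually hf] with z hz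
    using differentiableAt_reflect hz

lemma analyticOrderAt_reflect {f : ℂ → ℂ} {p : ℂ} (hf : AnalyticAt ℂ f (mirror p)) {n : ℕ}
    (hn : analyticOrderAt f (mirror p) = n) : analyticOrderAt (reflect f) p = n := by
  obtain ⟨g, hg, hg0, hfg⟩ := hf.analyticOrderAt_eq_natCast.1 hn
  rw [(analyticAt_reflect hf).analyticOrderAt_eq_natCast]
  -- The sign arises because the conjugate of `mirror z - mirror p` is -(z - p).
  refine ⟨fun z => (-1) ^ n * reflect g z, analyticAt_const.mul (analyticAt_reflect hg), ?_, ?_⟩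
  · simpa [reflect] using hg0
  · filter_upwards [continuous_mirror.continuousAt.eventually hfg] with z hz
    rw [reflect, hz, smul_eq_mul, smul_eq_mul, map_mul, map_pow, reflect, ← mul_assoc, ← mul_pow]
    congr 2
    simp [mirror]

end reflection

/-! ### Consequences of the functional equation high in the plane. -/

section functionalEquation

variable {r : ℕ} {lam : Fin r → ℝ} {mu : Fin r → ℂ}

/-- The point `s` lies so high that all arguments `λ_j s + μ_j` have imaginary part at least `1`. -/
def IsHigh (lam : Fin r → ℝ) (mu : Fin r → ℂ) (t : ℝ) : Prop :=
  0 < t ∧ ∀ j, 1 ≤ lam j * t + (mu j).im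

lemma IsHigh.mono (hlam : ∀ j, 0 < lam j) {t t' : ℝ} (h : IsHigh lam mu t) (ht : t ≤ t') :
    IsHigh lam mu t' :=
  ⟨h.1.trans_le ht, fun j => (h.2 j).trans (by have := hlam j; gcongr)⟩

lemma eventually_isHigh (hlam : ∀ j, 0 < lam j) :
    ∀ᶠ t : ℝ in Filter.atTop, IsHigh lam mu t := by
  refine (Filter.eventually_gt_atTop 0).and (Filter.eventually_all.2 fun j => ?_)
  exact (Filter.tendsto_atTop_add_const_right _ _
    (Filter.tendsto_id.const_mul_atTop (hlam j))).eventually_ge_atTop 1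

lemma IsHigh.im_ge {s : ℂ} (h : IsHigh lam mu s.im) (j : Fin r) :
    1 ≤ ((lam j : ℂ) * s + mu j).im := by
  simpa using h.2 j

lemma IsHigh.gammaRegular {s : ℂ} (h : IsHigh lam mu s.im) : GammaRegular lam mu s := by
  intro j m h0
  have := h.im_ge j
  rw [h0] at this
  norm_num at this

/-- The factor `Q^s ∏_j Γ(λ_j s + μ_j)` of the completed function. -/
noncomputable def gammaFactor (Q : ℝ) (lam : Fin r → ℝ) (mu : Fin r → ℂ) (s : ℂ) : ℂ :=
  (Q : ℂ) ^ s * ∏ j, Gamma ((lam j : ℂ) * s + mu j)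

lemma completed_eq (F : ℂ → ℂ) (Q : ℝ) (s : ℂ) :
    completed F Q lam mu s = F s * gammaFactor Q lam mu s := by
  rw [completed, gammaFactor, mul_assoc]

lemma gammaFactor_ne_zero {Q : ℝ} (hQ : 0 < Q) {s : ℂ} (h : IsHigh lam mu s.im) :
    gammaFactor Q lam mu s ≠ 0 :=
  mul_ne_zero (cpow_ne_zero_iff_of_exponent_ne_zero (by
      rintro rfl; exact absurd h.1 (by simp)) |>.2 (by exact_mod_cast hQ.ne'))
    (Finset.prod_ne_zero_iff.2 fun j _ => Gamma_ne_zero (h.gammaRegular j))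

lemma differentiableAt_gammaFactor {Q : ℝ} (hQ : 0 < Q) {s : ℂ} (h : IsHigh lam mu s.im) :
    DifferentiableAt ℂ (gammaFactor Q lam mu) s := by
  have hQ' : (Q : ℂ) ≠ 0 := by exact_mod_cast hQ.ne'
  refine DifferentiableAt.mul (differentiableAt_id.const_cpow (Or.inl hQ')) ?_
  refine DifferentiableAt.fun_finsetProd fun j _ => ?_
  exact (differentiableAt_Gamma _ (h.gammaRegular j)).comp s (by fun_prop)

lemma logDeriv_gammaFactor {Q : ℝ} (hQ : 0 < Q) {s : ℂ} (h : IsHigh lam mu s.im) :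
    logDeriv (gammaFactor Q lam mu) s =
      Real.log Q + ∑ j, (lam j : ℂ) * digamma ((lam j : ℂ) * s + mu j) := by
  have hQ' : (Q : ℂ) ≠ 0 := by exact_mod_cast hQ.ne'
  have hs0 : s ≠ 0 := by rintro rfl; exact absurd h.1 (by simp)
  have hd : ∀ j, DifferentiableAt ℂ (fun s => Gamma ((lam j : ℂ) * s + mu j)) s := fun j =>
    (differentiableAt_Gamma _ (h.gammaRegular j)).comp s (by fun_prop)
  have hne : ∀ j, Gamma ((lam j : ℂ) * s + mu j) ≠ 0 := fun j => Gamma_ne_zero (h.gammaRegular j)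
  have hcp : HasDerivAt (fun s : ℂ => (Q : ℂ) ^ s) ((Q : ℂ) ^ s * log Q) s := by
    simpa using (hasDerivAt_id s).const_cpow (Or.inl hQ')
  have hcp0 : (Q : ℂ) ^ s ≠ 0 := (cpow_ne_zero_iff_of_exponent_ne_zero hs0).2 hQ'
  unfold gammaFactor
  rw [logDeriv_mul s hcp0 (Finset.prod_ne_zero_iff.2 fun j _ => hne j) hcp.differentiableAt
    (DifferentiableAt.fun_finsetProd fun j _ => hd j), logDeriv_prod (fun j _ => hne j)
    (fun j _ => hd j)]
  congr 1
  · rw [logDeriv_apply, hcp.deriv, ofReal_log hQ.le]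
    field_simp
  · refine Finset.sum_congr rfl fun j _ => ?_
    have h1 : HasDerivAt (fun s : ℂ => (lam j : ℂ) * s + mu j) (lam j) s := by
      simpa using ((hasDerivAt_id s).const_mul (lam j : ℂ)).add_const (mu j)
    have h2 := (differentiableAt_Gamma _ (h.gammaRegular j)).hasDerivAt.comp s h1
    rw [logDeriv_apply, show deriv (fun s => Gamma ((lam j : ℂ) * s + mu j)) s = _ from h2.deriv,
      digamma_def, logDeriv_apply]
    ring

variable {F : ℂ → ℂ} {Q : ℝ} {ω : ℂ}

lemma FunctionalEquation.apply_of_isHigh (hFE : FunctionalEquation F Q ω lam mu) {s : ℂ}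
    (h : IsHigh lam mu s.im) :
    completed F Q lam mu s = ω * reflect (completed F Q lam mu) s := by
  have hm : IsHigh lam mu (mirror s).im := by rwa [mirror_im]
  refine hFE s ?_ ?_ h.gammaRegular hm.gammaRegular
  · rintro rfl; exact absurd h.1 (by simp)
  · rintro rfl; exact absurd h.1 (by simp)

lemma eventually_isHigh_nhds (hlam : ∀ j, 0 < lam j) {t : ℝ} (ht : IsHigh lam mu t) {s : ℂ}
    (hs : t < s.im) : ∀ᶠ z in nhds s, IsHigh lam mu z.im := by
  filter_upwards [continuous_im.continuousAt.eventually_mem (Ioi_mem_nhds hs)] with z hz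
    using ht.mono hlam (le_of_lt hz)

/-- The reflection fixes points of the line, so the functional equation gives Φ'/Φ = -conj(Φ'/Φ)
there. Hence Re Φ'/Φ = 0, and Re F'/F is minus the contribution of the Gamma factor. -/
lemma logDeriv_re_line (hlam : ∀ j, 0 < lam j) (hQ : 0 < Q) (hω : ‖ω‖ = 1)
    (hFE : FunctionalEquation F Q ω lam mu)
    {t : ℝ} (ht : IsHigh lam mu t) {s : ℂ} (hs : t < s.im) (hF : DifferentiableAt ℂ F s)
    (hre : s.re = 1 / 2) (h0 : F s ≠ 0) :
    (logDeriv F s).re =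
      -(Real.log Q + ∑ j, lam j * (digamma ((lam j : ℂ) * s + mu j)).re) := by
  have hh := ht.mono hlam hs.le
  have hms : mirror s = s := by
    apply Complex.ext
    · rw [mirror_re, hre]; norm_num
    · simp
  set f := completed F Q lam mu with hf
  have hfeq : f = fun s => F s * gammaFactor Q lam mu s := funext (completed_eq F Q)
  have hA0 := gammaFactor_ne_zero hQ hh
  have hAd := differentiableAt_gammaFactor hQ hh
  have hfd : DifferentiableAt ℂ f s := by rw [hfeq]; exact hF.mul hAd
  have hf0 : f s ≠ 0 := by rw [hfeq]; exact mul_ne_zero h0 hA0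
  have hev : f =ᶠ[nhds s] fun z => ω * reflect f z := by
    filter_upwards [eventually_isHigh_nhds hlam ht hs] with z hz using hFE.apply_of_isHigh hz
  have hr : HasDerivAt (reflect f) (-starRingEnd ℂ (deriv f s)) s :=
    hasDerivAt_reflect (by rw [hms]; exact hfd.hasDerivAt)
  have hω0 : ω ≠ 0 := norm_ne_zero_iff.1 (by rw [hω]; exact one_ne_zero)
  have h1 : logDeriv f s = -starRingEnd ℂ (logDeriv f s) := by
    have e1 : deriv f s = ω * -starRingEnd ℂ (deriv f s) := by
      conv_lhs => rw [hev.deriv_eq]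
      exact (hr.const_mul ω).deriv
    have e2 : f s = ω * starRingEnd ℂ (f s) := by
      have := hev.eq_of_nhds
      rwa [reflect, hms] at this
    rw [logDeriv_apply, map_div₀]
    calc deriv f s / f s = (ω * -starRingEnd ℂ (deriv f s)) / (ω * starRingEnd ℂ (f s)) := by
          rw [← e1, ← e2]
      _ = _ := by rw [mul_div_mul_left _ _ hω0, neg_div]
  have h2 : (logDeriv f s).re = 0 := by
    have := congrArg Complex.re h1
    simp at this
    linarith
  rw [hfeq, logDeriv_mul s h0 hA0 hF hAd, logDeriv_gammaFactor hQ hh, add_re, add_re, ofReal_re,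
    re_sum] at h2
  simp only [re_ofReal_mul] at h2
  linarith

/-- At this height the Gamma factor has neither zeros nor poles, so F and Φ have the same orders,
and those of Φ are symmetric. -/
lemma analyticOrderAt_mirror (hlam : ∀ j, 0 < lam j) (hQ : 0 < Q) (hω : ‖ω‖ = 1)
    (hFE : FunctionalEquation F Q ω lam mu)
    (hF : ∀ s : ℂ, 0 < s.im → AnalyticAt ℂ F s)
    {t : ℝ} (ht : IsHigh lam mu t) {p : ℂ} (hp : t < p.im) {n : ℕ}
    (hn : analyticOrderAt F (mirror p) = n) : analyticOrderAt F p = n := by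
  have hh := ht.mono hlam hp.le
  have hm : IsHigh lam mu (mirror p).im := by rwa [mirror_im]
  have hω0 : ω ≠ 0 := norm_ne_zero_iff.1 (by rw [hω]; exact one_ne_zero)
  have hA : ∀ z : ℂ, t < z.im → AnalyticAt ℂ (gammaFactor Q lam mu) z := fun z hz => by
    rw [analyticAt_iff_eventually_differentiableAt]
    filter_upwards [eventually_isHigh_nhds hlam ht hz] with w hw
      using differentiableAt_gammaFactor hQ hw
  set f := completed F Q lam mu with hf
  have hfeq : f = F * gammaFactor Q lam mu := funext (completed_eq F Q)
  have hord : ∀ z : ℂ, t < z.im → analyticOrderAt f z = analyticOrderAt F z := fun z hz => by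
    rw [hfeq, analyticOrderAt_mul (hF z (ht.1.trans hz)) (hA z hz),
      (hA z hz).analyticOrderAt_eq_zero.2 (gammaFactor_ne_zero hQ (ht.mono hlam hz.le)), add_zero]
  have hfa : ∀ z : ℂ, t < z.im → AnalyticAt ℂ f z := fun z hz => by
    rw [hfeq]; exact (hF z (ht.1.trans hz)).mul (hA z hz)
  have hp' : t < (mirror p).im := by rwa [mirror_im]
  have hev : f =ᶠ[nhds p] (fun _ => ω) * reflect f := by
    filter_upwards [eventually_isHigh_nhds hlam ht hp] with z hz using hFE.apply_of_isHigh hz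
  rw [← hord p hp, analyticOrderAt_congr hev,
    analyticOrderAt_mul analyticAt_const (analyticAt_reflect (hfa _ hp')),
    analyticAt_const.analyticOrderAt_eq_zero.2 hω0, zero_add]
  exact analyticOrderAt_reflect (hfa _ hp') (by rw [hord _ hp', hn])

lemma tendsto_sum_log (hlam : ∀ j, 0 < lam j) (hdeg : 0 < selbergDegree lam) :
    Filter.Tendsto (fun t : ℝ => ∑ j, lam j * (Real.log (lam j * t + (mu j).im) - 3))
      Filter.atTop Filter.atTop := by
  have hterm : ∀ j, Filter.Tendsto (fun t : ℝ => lam j * (Real.log (lam j * t + (mu j).im) - 3))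
      Filter.atTop Filter.atTop := fun j => by
    refine Filter.Tendsto.const_mul_atTop (hlam j) (Filter.tendsto_atTop_add_const_right _ (-3) ?_)
    exact Real.tendsto_log_atTop.comp (Filter.tendsto_atTop_add_const_right _ _
      (Filter.tendsto_id.const_mul_atTop (hlam j)))
  -- Positive degree enters here: without a Gamma factor the sum would be empty.
  have hr : Nonempty (Fin r) := by
    by_contra h
    rw [not_nonempty_iff] at h
    simp [selbergDegree] at hdeg
  obtain ⟨j₀⟩ := hr
  refine Filter.tendsto_atTop_mono' _ ?_ (hterm j₀)
  filter_upwards [Filter.eventually_all.2 fun j => (hterm j).eventually_ge_atTop 0] with t ht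
  exact Finset.single_le_sum (f := fun j => lam j * (Real.log (lam j * t + (mu j).im) - 3))
    (fun j _ => ht j) (Finset.mem_univ j₀)

/-- On the critical line the real part of `F'/F` is at most `-1` at large heights, uniformly in `F`
if `Q` is bounded below. -/
lemma eventually_logDeriv_re_le (hlam : ∀ j, 0 < lam j) (hmu : ∀ j, 0 ≤ (mu j).re)
    (hdeg : 0 < selbergDegree lam) {Q₀ : ℝ} (hQ₀ : 0 < Q₀) :
    ∃ t₁ : ℝ, ∀ (F : ℂ → ℂ) (Q : ℝ) (ω : ℂ), Q₀ ≤ Q → ‖ω‖ = 1 →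
      FunctionalEquation F Q ω lam mu → ∀ s : ℂ, t₁ < s.im → DifferentiableAt ℂ F s →
      s.re = 1 / 2 → F s ≠ 0 → (logDeriv F s).re ≤ -1 := by
  obtain ⟨t, ht⟩ := (eventually_isHigh (mu := mu) hlam).exists
  obtain ⟨t', ht'⟩ := Filter.eventually_atTop.1
    ((tendsto_sum_log (mu := mu) hlam hdeg).eventually_ge_atTop (1 - Real.log Q₀))
  refine ⟨max t t', fun F Q ω hQ hω hFE s hs hF hre h0 => ?_⟩
  have hst := (le_max_left _ _).trans_lt hs
  have hst' := (le_max_right _ _).trans hs.le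
  rw [logDeriv_re_line hlam (hQ₀.trans_le hQ) hω hFE ht hst hF hre h0]
  have h1 := ht' _ hst'
  have h2 := Real.log_le_log hQ₀ hQ
  have h3 : ∑ j, lam j * (Real.log (lam j * s.im + (mu j).im) - 3) ≤
      ∑ j, lam j * (digamma ((lam j : ℂ) * s + mu j)).re := by
    refine Finset.sum_le_sum fun j _ => mul_le_mul_of_nonneg_left ?_ (hlam j).le
    have := log_im_sub_le_digamma_re (s := (lam j : ℂ) * s + mu j)
      (by
        have := hlam j
        have := hmu j
        simp [hre]
        positivity) ((ht.mono hlam hst.le).im_ge j)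
    simpa using this
  linarith

end functionalEquation

/-! ### A uniform lower bound for Q. -/

section conductor

lemma norm_le_of_rectBoundary {f : ℂ → ℂ} {a b c d C : ℝ} (hab : a ≤ b) (hcd : c ≤ d)
    (hf : DifferentiableOn ℂ f (closedRect a b c d))
    (hC : ∀ z ∈ rectBoundary a b c d, ‖f z‖ ≤ C) {z : ℂ} (hz : z ∈ closedRect a b c d) :
    ‖f z‖ ≤ C := by
  have hc : IsCompact (closedRect a b c d) := by
    rw [closedRect_eq hab hcd]; exact isCompact_uIcc.reProdIm isCompact_uIcc
  refine norm_le_of_forall_mem_frontier_norm_le hc.isBounded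
    (DifferentiableOn.diffContOnCl (by rwa [hc.isClosed.closure_eq])) (fun w hw => hC w ?_)
    (subset_closure hz)
  have hwK := hc.isClosed.frontier_subset hw
  refine ⟨hwK, ?_⟩
  by_contra hne
  push Not at hne
  obtain ⟨k1, k2, k3, k4⟩ := hwK
  have hopen : IsOpen (Set.Ioo a b ×ℂ Set.Ioo c d) := isOpen_Ioo.reProdIm isOpen_Ioo
  have hsub : Set.Ioo a b ×ℂ Set.Ioo c d ⊆ closedRect a b c d := fun z hz =>
    ⟨hz.1.1.le, hz.1.2.le, hz.2.1.le, hz.2.2.le⟩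
  refine hw.2 (interior_maximal hsub hopen ⟨⟨?_, ?_⟩, ⟨?_, ?_⟩⟩)
  · exact lt_of_le_of_ne k1 hne.1.symm
  · exact lt_of_le_of_ne k2 hne.2.1
  · exact lt_of_le_of_ne k3 hne.2.2.1.symm
  · exact lt_of_le_of_ne k4 hne.2.2.2

lemma sinh_re (z : ℂ) : (sinh z).re = Real.sinh z.re * Real.cos z.im := by
  conv_lhs => rw [← re_add_im z, sinh_add, sinh_mul_I, cosh_mul_I]
  simp [sinh_ofReal_re, cos_ofReal_re]

/-- A two-constants inequality on a rectangle of height `2`. -/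
lemma norm_mul_exp_le_of_rect {f : ℂ → ℂ} {a b t₀ x U L M : ℝ} (hM : 0 ≤ M) (hax : a ≤ x)
    (hxb : x ≤ b) (hf : DifferentiableOn ℂ f (closedRect a b (t₀ - 1) (t₀ + 1)))
    (hU : ∀ z ∈ closedRect a b (t₀ - 1) (t₀ + 1), ‖f z‖ ≤ U)
    (hL : ∀ z ∈ closedRect a b (t₀ - 1) (t₀ + 1), z.re = a → ‖f z‖ ≤ L) :
    ‖f (x + t₀ * I)‖ * Real.exp (M * Real.sinh (Real.pi / 2 * (b - x))) ≤
      max U (L * Real.exp (M * Real.sinh (Real.pi / 2 * (b - a)))) := by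
  -- Re h = sinh(π(b - σ)/2) cos(π(t₀ - t)/2) is a harmonic weight vanishing on the top, bottom and
  -- right sides. Thus exp(Mh) costs nothing there and only the left side pays.
  set h : ℂ → ℂ := fun s => sinh ((Real.pi / 2 : ℝ) * (b + t₀ * I - s)) with hh
  have hre : ∀ s, (h s).re =
      Real.sinh (Real.pi / 2 * (b - s.re)) * Real.cos (Real.pi / 2 * (t₀ - s.im)) := by
    intro s
    rw [hh]
    simp only
    rw [sinh_re, re_ofReal_mul, im_ofReal_mul]
    simp
  have hnorm : ∀ s, ‖f s * exp (M * h s)‖ = ‖f s‖ * Real.exp (M * (h s).re) := fun s => by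
    rw [norm_mul, norm_exp, re_ofReal_mul]
  have hpi := Real.pi_pos
  have key := norm_le_of_rectBoundary (f := fun s => f s * exp (M * h s)) (hax.trans hxb)
    (by linarith : t₀ - 1 ≤ t₀ + 1) (C := max U (L * Real.exp (M * Real.sinh (Real.pi / 2 * (b - a)))))
    (hf.mul (Differentiable.differentiableOn (by rw [hh]; fun_prop))) ?_
    (z := x + t₀ * I) (by simp [closedRect, hax, hxb])
  · rw [hnorm, hre] at key
    simpa using key
  · rintro z ⟨hzK, hz⟩
    rw [hnorm, hre]
    have hzero : Real.sinh (Real.pi / 2 * (b - z.re)) * Real.cos (Real.pi / 2 * (t₀ - z.im)) = 0 →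
        ‖f z‖ * Real.exp (M * (Real.sinh (Real.pi / 2 * (b - z.re)) *
          Real.cos (Real.pi / 2 * (t₀ - z.im)))) ≤
          max U (L * Real.exp (M * Real.sinh (Real.pi / 2 * (b - a)))) := fun h0 => by
      rw [h0, mul_zero, Real.exp_zero, mul_one]
      exact (hU z hzK).trans (le_max_left _ _)
    rcases hz with hz | hz | hz | hz
    · refine le_trans ?_ (le_max_right _ _)
      have hS : 0 ≤ Real.sinh (Real.pi / 2 * (b - a)) :=
        Real.sinh_nonneg_iff.2 (mul_nonneg (by positivity) (by linarith))
      have h1 := hL z hzK hz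
      rw [hz]
      gcongr
      · exact (norm_nonneg _).trans h1
      · exact mul_le_of_le_one_right hS (Real.cos_le_one _)
    · exact hzero (by rw [hz]; simp)
    · refine hzero ?_
      rw [hz, sub_sub_cancel, mul_one, Real.cos_pi_div_two, mul_zero]
    · refine hzero ?_
      rw [hz, sub_add_cancel_left, mul_neg, mul_one, Real.cos_neg, Real.cos_pi_div_two, mul_zero]

variable {r : ℕ} {lam : Fin r → ℝ} {mu : Fin r → ℂ}

lemma norm_gammaFactor {Q : ℝ} (hQ : 0 < Q) (s : ℂ) :
    ‖gammaFactor Q lam mu s‖ = Q ^ s.re * ∏ j, ‖Gamma ((lam j : ℂ) * s + mu j)‖ := by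
  rw [gammaFactor, norm_mul, norm_prod, norm_cpow_eq_rpow_re_of_pos hQ]

/-- The constant `Q` of the functional equation is bounded below in terms of the bounds on `F`. -/
lemma exists_conductor_lower_bound {σ₁ c B : ℝ} (hσ₁ : 1 < σ₁) (hc : 0 < c) (hB : 0 < B)
    (hlam : ∀ j, 0 < lam j) :
    ∃ Q₀ : ℝ, 0 < Q₀ ∧ ∀ (F : ℂ → ℂ) (Q : ℝ) (ω : ℂ), 0 < Q → ‖ω‖ = 1 →
      FunctionalEquation F Q ω lam mu → (∀ s : ℂ, 0 < s.im → DifferentiableAt ℂ F s) →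
      (∀ t : ℝ, c ≤ ‖F ((σ₁ : ℂ) + t * I)‖) →
      (∀ σ T : ℝ, 10 < T → -4 * σ₁ ≤ σ → ‖F ((σ : ℂ) + T * I)‖ < T ^ B) → Q₀ ≤ Q := by
  obtain ⟨t₂, ht₂, ht₂'⟩ := ((eventually_isHigh (mu := mu) hlam).and
    (Filter.eventually_gt_atTop 10)).exists
  set t₀ := t₂ + 1 with ht₀
  set U : ℝ := (t₀ + 1) ^ B with hU
  have hU0 : 0 < U := Real.rpow_pos_of_pos (by linarith) _
  set P : ℝ → ℝ → ℝ := fun σ s => ∏ j, ‖Gamma ((lam j : ℂ) * (σ + s * I) + mu j)‖ with hP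
  have hhigh : ∀ σ t : ℝ, t₂ ≤ t → IsHigh lam mu ((σ : ℂ) + t * I).im := fun σ t ht => by
    simpa using ht₂.mono hlam ht
  have hPpos : ∀ σ t : ℝ, t₂ ≤ t → 0 < P σ t := fun σ t ht =>
    Finset.prod_pos fun j _ => norm_pos_iff.2 (Gamma_ne_zero ((hhigh σ t ht).gammaRegular j))
  have hPcont : ∀ σ : ℝ, ContinuousOn (fun t : ℝ => P σ t) (Set.Icc (t₀ - 1) (t₀ + 1)) := by
    intro σ t ht
    refine ContinuousAt.continuousWithinAt (tendsto_finsetProd _ fun j _ => ?_)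
    have h1 : ContinuousAt Gamma ((lam j : ℂ) * (σ + t * I) + mu j) :=
      (differentiableAt_Gamma _ ((hhigh σ t (by linarith [ht.1])).gammaRegular j)).continuousAt
    exact (h1.comp (f := fun t : ℝ => (lam j : ℂ) * (σ + t * I) + mu j) (by fun_prop)).norm
  obtain ⟨C, hC⟩ := (isCompact_Icc.image_of_continuousOn
    (((hPcont (1 + 4 * σ₁)).div (hPcont (-4 * σ₁)) fun t ht =>
      (hPpos _ t (by linarith [ht.1])).ne'))).isBounded.bddAbove
  have hC' : ∀ t ∈ Set.Icc (t₀ - 1) (t₀ + 1), P (1 + 4 * σ₁) t / P (-4 * σ₁) t ≤ C := fun t ht =>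
    hC ⟨t, ht, rfl⟩
  have hC0 : 0 < C := (div_pos (hPpos (1 + 4 * σ₁) t₀ (by linarith))
    (hPpos (-4 * σ₁) t₀ (by linarith))).trans_le (hC' t₀ ⟨by linarith, by linarith⟩)
  have hpi := Real.pi_pos
  set S₁ := Real.sinh (Real.pi / 2 * (σ₁ + 1 - σ₁)) with hS₁
  set S := Real.sinh (Real.pi / 2 * (σ₁ + 1 - -4 * σ₁)) with hS
  have hS₁0 : 0 < S₁ := Real.sinh_pos_iff.2 (by simp; positivity)
  -- M is so large that the bound U on the three other sides alone would contradict |F| ≥ c at σ₁ +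
  -- it₀; the left side must then carry the maximum.
  obtain ⟨M, hM0, hM⟩ : ∃ M : ℝ, 0 ≤ M ∧ U < c * Real.exp (M * S₁) := by
    refine ⟨U / (c * S₁), by positivity, ?_⟩
    have h1 := Real.add_one_le_exp (U / (c * S₁) * S₁)
    have h2 : c * (U / (c * S₁) * S₁) = U := by field_simp
    nlinarith
  set K := c * Real.exp (M * S₁) / (C * U * Real.exp (M * S)) with hK
  have hK0 : 0 < K := by positivity
  refine ⟨K ^ (1 + 8 * σ₁)⁻¹, Real.rpow_pos_of_pos hK0 _, ?_⟩
  intro F Q ω hQ hω hFE hd hlow hup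
  have hbound : ∀ σ t : ℝ, -4 * σ₁ ≤ σ → t ∈ Set.Icc (t₀ - 1) (t₀ + 1) →
      ‖F ((σ : ℂ) + t * I)‖ ≤ U := fun σ t hσ ht =>
    (hup σ t (by linarith [ht.1]) hσ).le.trans
      (Real.rpow_le_rpow (by linarith [ht.1]) ht.2 hB.le)
  have hdecomp : ∀ z : ℂ, ((z.re : ℝ) : ℂ) + (z.im : ℝ) * I = z := re_add_im
  -- The functional equation compares σ = -4σ₁ with σ = 1 + 4σ₁ and produces the factor Q^(1 + 8σ₁),
  -- so a tiny Q would make F tiny on the left side.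
  have hleft : ∀ t ∈ Set.Icc (t₀ - 1) (t₀ + 1),
      ‖F (((-4 * σ₁ : ℝ) : ℂ) + t * I)‖ ≤ Q ^ (1 + 8 * σ₁) * C * U := by
    intro t ht
    have htt : t₂ ≤ t := by linarith [ht.1]
    set s : ℂ := ((-4 * σ₁ : ℝ) : ℂ) + t * I with hs
    have hms : mirror s = ((1 + 4 * σ₁ : ℝ) : ℂ) + t * I := by
      apply Complex.ext <;> simp [hs]
    have h1 := congrArg norm (hFE.apply_of_isHigh (hhigh (-4 * σ₁) t htt))
    rw [← hs, norm_mul, hω, one_mul, reflect, Complex.norm_conj, completed_eq, completed_eq,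
      norm_mul, norm_mul, norm_gammaFactor hQ, norm_gammaFactor hQ, hms] at h1
    have hp1 := hPpos (1 + 4 * σ₁) t htt
    have hp2 := hPpos (-4 * σ₁) t htt
    have hre1 : s.re = -4 * σ₁ := by simp [hs]
    have hre2 : (((1 + 4 * σ₁ : ℝ) : ℂ) + t * I).re = 1 + 4 * σ₁ := by simp
    rw [hre1, hre2] at h1
    change ‖F s‖ * (Q ^ (-4 * σ₁) * P (-4 * σ₁) t) =
      ‖F (((1 + 4 * σ₁ : ℝ) : ℂ) + t * I)‖ * (Q ^ (1 + 4 * σ₁) * P (1 + 4 * σ₁) t) at h1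
    have hq : Q ^ (1 + 4 * σ₁) = Q ^ (1 + 8 * σ₁) * Q ^ (-4 * σ₁) := by
      rw [← Real.rpow_add hQ]; congr 1; ring
    have hq0 : 0 < Q ^ (-4 * σ₁) := Real.rpow_pos_of_pos hQ _
    have hq1 : 0 < Q ^ (1 + 8 * σ₁) := Real.rpow_pos_of_pos hQ _
    have h2 : ‖F s‖ = Q ^ (1 + 8 * σ₁) * (P (1 + 4 * σ₁) t / P (-4 * σ₁) t) *
        ‖F (((1 + 4 * σ₁ : ℝ) : ℂ) + t * I)‖ := by
      rw [hq] at h1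
      rw [mul_div_assoc', div_mul_eq_mul_div, eq_div_iff hp2.ne']
      exact mul_left_cancel₀ hq0.ne' (by linear_combination h1)
    rw [h2]
    gcongr
    · exact hC' t ht
    · exact hbound _ t (by linarith) ht
  have hmain := norm_mul_exp_le_of_rect (f := F) (a := -4 * σ₁) (b := σ₁ + 1) (t₀ := t₀) (x := σ₁)
    (U := U) (L := Q ^ (1 + 8 * σ₁) * C * U) hM0 (by linarith) (by linarith)
    (fun z hz => (hd z (by linarith [hz.2.2.1])).differentiableWithinAt)
    (fun z hz => by
      have := hbound z.re z.im hz.1 ⟨hz.2.2.1, hz.2.2.2⟩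
      rwa [hdecomp] at this)
    (fun z hz hza => by
      have := hleft z.im ⟨hz.2.2.1, hz.2.2.2⟩
      rwa [← hza, hdecomp] at this)
  rw [← hS₁, ← hS] at hmain
  have h3 : c * Real.exp (M * S₁) ≤ Q ^ (1 + 8 * σ₁) * C * U * Real.exp (M * S) := by
    have h4 : c * Real.exp (M * S₁) ≤ ‖F (σ₁ + t₀ * I)‖ * Real.exp (M * S₁) := by
      gcongr
      exact hlow t₀
    rcases le_max_iff.1 (h4.trans hmain) with h5 | h5
    · linarith
    · exact h5
  have h4 : K ≤ Q ^ (1 + 8 * σ₁) := by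
    rw [hK, div_le_iff₀ (by positivity)]
    linarith
  calc K ^ (1 + 8 * σ₁)⁻¹ ≤ (Q ^ (1 + 8 * σ₁)) ^ (1 + 8 * σ₁)⁻¹ :=
        Real.rpow_le_rpow hK0.le h4 (by positivity)
    _ = Q := Real.rpow_rpow_inv hQ.le (by positivity)

end conductor

/-! ### Landau's local factorization. -/

section landau

/-- The zeros of `F` near a point are split off; the logarithmic derivative of the remaining factor
has small derivative. -/
lemma exists_landau_factorization {F : ℂ → ℂ} {U : Set ℂ} (hU : IsOpen U)
    (hF : DifferentiableOn ℂ F U) {a : ℂ} {σ c M : ℝ} (hσ : 1 < σ)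
    (hsub : Metric.closedBall a (5 * σ) ⊆ U) (hM : ∀ s ∈ Metric.closedBall a (5 * σ), ‖F s‖ ≤ M)
    (hc : 0 < c) (ha : c ≤ ‖F a‖) :
    ∃ (Z : Finset ℂ) (m : ℂ → ℕ) (H : ℂ → ℂ),
      (∀ z, z ∈ Z ↔ z ∈ Metric.closedBall a (2 * σ) ∧ F z = 0) ∧
      (∀ p ∈ Z, analyticOrderAt F p = m p ∧ 1 ≤ m p) ∧ DifferentiableOn ℂ H U ∧
      (∀ z ∈ Metric.closedBall a (2 * σ), H z ≠ 0) ∧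
      (∀ s ∈ U, F s = (∏ p ∈ Z, (s - p) ^ m p) * H s) ∧
      (∑ p ∈ Z, (m p : ℝ)) * Real.log (3 / 2) ≤ Real.log (M / c) ∧
      ∀ s ∈ Metric.ball a σ, ‖deriv (logDeriv H) s‖ ≤ 64 * σ * (Real.log (M / c) + 1) := by
  have hKsub : Metric.closedBall a (2 * σ) ⊆ Metric.closedBall a (5 * σ) :=
    Metric.closedBall_subset_closedBall (by linarith)
  have haK : a ∈ Metric.closedBall a (2 * σ) := Metric.mem_closedBall_self (by linarith)
  have hFa : F a ≠ 0 := norm_pos_iff.1 (hc.trans_le ha)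
  have hM0 : 0 < M := (hc.trans_le ha).trans_le (hM a (hKsub haK))
  have hcM : 1 ≤ M / c := by rw [le_div_iff₀ hc, one_mul]; exact ha.trans (hM a (hKsub haK))
  have han : AnalyticOnNhd ℂ F (Metric.closedBall a (2 * σ)) := fun z hz =>
    hF.analyticAt (hU.mem_nhds (hsub (hKsub hz)))
  have hord : ∀ z ∈ Metric.closedBall a (2 * σ), analyticOrderAt F z ≠ ⊤ := by
    intro z hz
    refine han.analyticOrderAt_ne_top_of_isPreconnected
      (convex_closedBall a (2 * σ)).isPreconnected haK hz ?_
    rw [(han a haK).analyticOrderAt_eq_zero.2 hFa]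
    exact ENat.zero_ne_top
  obtain ⟨Z, m, H, hZ, hm, hH, hHK, hFH⟩ := exists_factorization hU hF
    (isCompact_closedBall a (2 * σ)) (hKsub.trans hsub) hord
  set n := ∑ p ∈ Z, m p with hn
  have hcast : (∑ p ∈ Z, (m p : ℝ)) = (n : ℝ) := by rw [hn]; push_cast; rfl
  -- On the circle of radius 5σ every split-off zero is at distance at least 3σ, but at most 2σ from
  -- the centre. Each zero thus gains a factor 2/3 in |H(s)/H(a)|, which also bounds the number of
  -- zeros by taking s = a.
  have hHbound : ∀ s ∈ Metric.closedBall a (5 * σ), ‖H s‖ ≤ M / (3 * σ) ^ n := by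
    intro s hs
    refine norm_le_of_forall_mem_frontier_norm_le (U := Metric.ball a (5 * σ))
      Metric.isBounded_ball ?_ (fun z hz => ?_) (z := s) ?_
    · refine DifferentiableOn.diffContOnCl (hH.mono ?_)
      exact Metric.closure_ball_subset_closedBall.trans hsub
    · rw [frontier_ball a (by linarith : 5 * σ ≠ 0)] at hz
      have hzc := Metric.sphere_subset_closedBall hz
      have h1 := hM z hzc
      rw [hFH z (hsub hzc), norm_mul] at h1
      have h2 : (3 * σ) ^ n ≤ ‖∏ p ∈ Z, (z - p) ^ m p‖ := by
        rw [norm_prod, hn, ← Finset.prod_pow_eq_pow_sum]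
        refine Finset.prod_le_prod (fun p _ => by positivity) fun p hp => ?_
        rw [norm_pow]
        refine pow_le_pow_left₀ (by positivity) ?_ _
        have h3 := ((hZ p).1 hp).1
        rw [Metric.mem_closedBall] at h3
        rw [Metric.mem_sphere] at hz
        have := dist_triangle z p a
        rw [← dist_eq_norm]
        linarith
      rw [le_div_iff₀ (by positivity), mul_comm]
      exact (mul_le_mul_of_nonneg_right h2 (norm_nonneg _)).trans h1
    · rwa [closure_ball a (by linarith : 5 * σ ≠ 0)]
  have hHa : c / (2 * σ) ^ n ≤ ‖H a‖ := by
    rw [hFH a (hsub (hKsub haK)), norm_mul] at ha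
    have h2 : ‖∏ p ∈ Z, (a - p) ^ m p‖ ≤ (2 * σ) ^ n := by
      rw [norm_prod, hn, ← Finset.prod_pow_eq_pow_sum]
      refine Finset.prod_le_prod (fun p _ => by positivity) fun p hp => ?_
      rw [norm_pow]
      refine pow_le_pow_left₀ (by positivity) ?_ _
      have h3 := ((hZ p).1 hp).1
      rwa [Metric.mem_closedBall, dist_comm, dist_eq_norm] at h3
    rw [div_le_iff₀ (by positivity), mul_comm]
    exact ha.trans (mul_le_mul_of_nonneg_right h2 (norm_nonneg _))
  have hratio : ∀ s ∈ Metric.closedBall a (5 * σ), ‖H s‖ / ‖H a‖ ≤ M / c / (3 / 2) ^ n := by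
    intro s hs
    calc ‖H s‖ / ‖H a‖ ≤ (M / (3 * σ) ^ n) / (c / (2 * σ) ^ n) := by
          gcongr
          exact hHbound s hs
      _ = M / c / (3 / 2) ^ n := by
          rw [show (3 : ℝ) * σ = 3 / 2 * (2 * σ) by ring, mul_pow]
          field_simp
  have hHa0 : H a ≠ 0 := hHK a haK
  have hpow : (3 / 2 : ℝ) ^ n ≤ M / c := by
    have := hratio a (hKsub haK)
    rw [div_self (norm_ne_zero_iff.2 hHa0), le_div_iff₀ (by positivity), one_mul] at this
    exact this
  refine ⟨Z, m, H, hZ, hm, hH, hHK, hFH, ?_, ?_⟩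
  · rw [hcast, ← Real.log_pow]
    exact Real.log_le_log (by positivity) hpow
  -- The added 1 makes the bound positive, as Borel–Carathéodory requires.
  set Λ := Real.log (M / c) + 1 with hΛ
  have hΛ1 : 1 ≤ Λ := by linarith [Real.log_nonneg hcM]
  have hballK : Metric.ball a (2 * σ) ⊆ Metric.closedBall a (2 * σ) := Metric.ball_subset_closedBall
  have hHan : ∀ z ∈ Metric.ball a (2 * σ), AnalyticAt ℂ H z := fun z hz =>
    hH.analyticAt (hU.mem_nhds (hsub (hKsub (hballK hz))))
  have hlogd : DifferentiableOn ℂ (logDeriv H) (Metric.ball a (2 * σ)) := fun z hz =>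
    ((hHan z hz).deriv.differentiableAt.div (hHan z hz).differentiableAt
      (hHK z (hballK hz))).differentiableWithinAt
  obtain ⟨ℓ₀, hℓ₀⟩ := hlogd.isExactOn_ball
  set ℓ : ℂ → ℂ := fun z => ℓ₀ z - ℓ₀ a with hℓ
  have hℓd : ∀ z ∈ Metric.ball a (2 * σ), HasDerivAt ℓ (logDeriv H z) z := fun z hz =>
    (hℓ₀ z hz).sub_const _
  have hℓa : ℓ a = 0 := sub_self _
  have hab : a ∈ Metric.ball a (2 * σ) := Metric.mem_ball_self (by linarith)
  -- ℓ is a logarithm of H/H(a), so the bound on |H/H(a)| becomes one on Re ℓ.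
  have hexp : ∀ z ∈ Metric.ball a (2 * σ), H z * exp (-ℓ z) = H a := by
    intro z hz
    have hder : ∀ w ∈ Metric.ball a (2 * σ),
        HasDerivWithinAt (fun z => H z * exp (-ℓ z)) 0 (Metric.ball a (2 * σ)) w := fun w hw => by
      have h1 := ((hHan w hw).differentiableAt.hasDerivAt).mul ((hℓd w hw).neg.cexp)
      refine (h1.congr_deriv ?_).hasDerivWithinAt
      have := hHK w (hballK hw)
      rw [logDeriv_apply]
      field_simp
      simp
    have h2 := (convex_ball a (2 * σ)).norm_image_sub_le_of_norm_hasDerivWithin_le hder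
      (C := 0) (by simp) hab hz
    rw [zero_mul, norm_le_zero_iff, sub_eq_zero] at h2
    rw [h2, hℓa]
    simp
  have hℓre : ∀ z ∈ Metric.ball a (2 * σ), (ℓ z).re ≤ Λ := by
    intro z hz
    have h1 : ‖H z‖ = ‖H a‖ * Real.exp (ℓ z).re := by
      rw [← hexp z hz, norm_mul, norm_exp, neg_re, mul_assoc, ← Real.exp_add]
      simp
    have h2 := hratio z (hKsub (hballK hz))
    rw [h1, mul_div_cancel_left₀ _ (norm_ne_zero_iff.2 hHa0)] at h2
    have h3 : M / c / (3 / 2) ^ n ≤ M / c :=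
      div_le_self (by positivity) (one_le_pow₀ (by norm_num))
    have h4 := (Real.le_log_iff_exp_le (by positivity)).2 (h2.trans h3)
    linarith
  -- Borel–Carathéodory between the radii σ + 1/2 and 2σ; the gap σ - 1/2 is bounded below since σ >
  -- 1.
  have hℓnorm : ∀ z, ‖z - a‖ ≤ σ + 1 / 2 → ‖ℓ z‖ ≤ 8 * σ * Λ := by
    intro z hz
    have hdiff : DifferentiableOn ℂ (fun w => ℓ (a + w)) (Metric.ball 0 (2 * σ)) := by
      intro w hw
      have hw' : a + w ∈ Metric.ball a (2 * σ) := by simpa using hw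
      exact ((hℓd _ hw').comp_const_add a w).differentiableAt.differentiableWithinAt
    have h1 := borelCaratheodory_zero (f := fun w => ℓ (a + w)) (M := Λ) (R := 2 * σ) (z := z - a)
      (by linarith) hdiff (fun w hw => hℓre _ (by simpa using hw)) (by linarith)
      (by rw [mem_ball_zero_iff]; linarith) (by simpa using hℓa)
    rw [add_sub_cancel] at h1
    refine h1.trans ?_
    rw [div_le_iff₀ (by linarith)]
    nlinarith [norm_nonneg (z - a), mul_nonneg (by linarith : 0 ≤ Λ) (by linarith : 0 ≤ σ)]
  intro s hs
  have hs' : ‖s - a‖ < σ := by rwa [← dist_eq_norm]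
  have hsb : ∀ z ∈ Metric.closedBall s (1 / 2), ‖z - a‖ ≤ σ + 1 / 2 := by
    intro z hz
    rw [Metric.mem_closedBall, dist_eq_norm] at hz
    have := norm_add_le (z - s) (s - a)
    rw [sub_add_sub_cancel] at this
    linarith
  have hsb' : ∀ z ∈ Metric.closedBall s (1 / 2), z ∈ Metric.ball a (2 * σ) := fun z hz => by
    rw [Metric.mem_ball, dist_eq_norm]
    linarith [hsb z hz]
  have hev : deriv ℓ =ᶠ[nhds s] logDeriv H := by
    have : Metric.ball a (2 * σ) ∈ nhds s :=
      Metric.isOpen_ball.mem_nhds (hsb' s (Metric.mem_closedBall_self (by norm_num)))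
    filter_upwards [this] with z hz using (hℓd z hz).deriv
  have hcl : DiffContOnCl ℂ ℓ (Metric.ball s (1 / 2)) := by
    refine DifferentiableOn.diffContOnCl fun z hz => ?_
    exact (hℓd z (hsb' z (Metric.closure_ball_subset_closedBall hz))).differentiableAt
      |>.differentiableWithinAt
  -- Cauchy's estimate for ℓ'' on a circle of radius 1/2: 2!·8σΛ/(1/2)² = 64σΛ.
  have h2 := norm_iteratedDeriv_le_of_forall_mem_sphere_norm_le 2 (by norm_num) hcl
    (C := 8 * σ * Λ) fun z hz => hℓnorm z (hsb z (Metric.sphere_subset_closedBall hz))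
  rw [iteratedDeriv_succ, iteratedDeriv_one, hev.deriv_eq] at h2
  refine h2.trans (le_of_eq ?_)
  norm_num [Nat.factorial]
  ring

end landau

/-! ### Holomorphy of F and the choice of an annulus. -/

lemma IsExtendedSelberg.differentiableAt {F : ℂ → ℂ} (hF : IsExtendedSelberg F) {s : ℂ}
    (hs : s ≠ 1) : DifferentiableAt ℂ F s := by
  obtain ⟨k, G, hG, -, hGF⟩ := hF.continuation
  have h1 : DifferentiableAt ℂ (fun z => G z / (z - 1) ^ k) s :=
    (hG s).div (by fun_prop) (pow_ne_zero _ (sub_ne_zero.2 hs))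
  refine h1.congr_of_eventuallyEq ?_
  filter_upwards [isOpen_ne.mem_nhds hs] with z hz
  rw [hGF z hz, mul_div_cancel_left₀]
  exact pow_ne_zero _ (sub_ne_zero.2 hz)

lemma IsExtendedSelberg.differentiableAt_of_im_pos {F : ℂ → ℂ} (hF : IsExtendedSelberg F) {s : ℂ}
    (hs : 0 < s.im) : DifferentiableAt ℂ F s :=
  hF.differentiableAt (by rintro rfl; simp at hs)

lemma isOpen_im_pos : IsOpen {s : ℂ | 0 < s.im} := isOpen_lt continuous_const continuous_im

lemma IsExtendedSelberg.differentiableOn {F : ℂ → ℂ} (hF : IsExtendedSelberg F) :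
    DifferentiableOn ℂ F {s | 0 < s.im} := fun _ hs =>
  (hF.differentiableAt_of_im_pos hs).differentiableWithinAt

lemma IsExtendedSelberg.analyticAt {F : ℂ → ℂ} (hF : IsExtendedSelberg F) {s : ℂ}
    (hs : 0 < s.im) : AnalyticAt ℂ F s :=
  hF.differentiableOn.analyticAt (isOpen_im_pos.mem_nhds hs)

lemma abs_im_sub_le (p : ℂ) (T : ℝ) : |p.im - T| ≤ ‖p - (1 / 2 + T * I)‖ := by
  have := abs_im_le_norm (p - (1 / 2 + T * I))
  simpa using this

/-- If there are fewer than `2 J` zeros, one of `J` disjoint annuli around `1/2 + iT` contains no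
zero off the critical line, as these zeros come in pairs. -/
lemma exists_annulus_of_zeroCount_lt {F : ℂ → ℂ} {T x₀ q : ℝ} {J n : ℕ} (hT : 1 < T) (hx₀ : 0 < x₀)
    (hq : 1 ≤ q) (hxT : Real.exp (-x₀) ≤ 1 / T) (hF : ∀ s : ℂ, 0 < s.im → AnalyticAt ℂ F s)
    (hsymm : ∀ p : ℂ, |p.im - T| ≤ 1 / T → F p = 0 → F (mirror p) = 0)
    (hn : zeroCount F {s : ℂ | |s.im - T| ≤ 1 / T} = n) (hnJ : n < 2 * J) :
    ∃ j < J, ∀ p : ℂ, F p = 0 → p.re ≠ 1 / 2 →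
      ‖p - (1 / 2 + T * I)‖ < Real.exp (-(x₀ * q ^ j)) →
      ‖p - (1 / 2 + T * I)‖ ≤ Real.exp (-(x₀ * q ^ (j + 1))) := by
  classical
  by_contra! hcon
  choose p hp0 hpre hplt hpgt using fun j : Fin J => hcon j j.2
  have hmono : ∀ i j : ℕ, i ≤ j → Real.exp (-(x₀ * q ^ j)) ≤ Real.exp (-(x₀ * q ^ i)) := by
    intro i j hij
    have := pow_le_pow_right₀ hq hij
    gcongr
  have hpT : ∀ j, |(p j).im - T| ≤ 1 / T := fun j => by
    have := hmono 0 j (Nat.zero_le _)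
    rw [pow_zero, mul_one] at this
    linarith [hplt j, abs_im_sub_le (p j) T]
  have hT1 : 1 / T < 1 := by rw [div_lt_one (by linarith)]; exact hT
  have him : ∀ s : ℂ, |s.im - T| ≤ 1 / T → 0 < s.im := fun s hs => by
    linarith [(abs_le.1 hs).1]
  -- One zero from each annulus together with its mirror image: distinct annuli give distinct
  -- distances, and an off-line zero differs from its image, so these are 2J different zeros.
  set e : Fin J × Bool → ℂ := fun jb => if jb.2 then p jb.1 else mirror (p jb.1) with he
  have henorm : ∀ jb, ‖e jb - (1 / 2 + T * I)‖ = ‖p jb.1 - (1 / 2 + T * I)‖ := by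
    rintro ⟨j, b⟩
    cases b
    · simpa [he] using norm_mirror_sub (p j) T
    · simp [he]
  have hlt : ∀ i j : Fin J, i < j → ‖p j - (1 / 2 + T * I)‖ < ‖p i - (1 / 2 + T * I)‖ :=
    fun i j hij => (hplt j).trans_le (hmono (i + 1) j hij) |>.trans (hpgt i)
  have hinj : Function.Injective e := by
    rintro ⟨i, b⟩ ⟨j, b'⟩ h
    have h1 := henorm (i, b)
    rw [h, henorm] at h1
    have hij : i = j := by
      rcases lt_trichotomy i j with h2 | h2 | h2
      · exact absurd h1 (hlt i j h2).ne
      · exact h2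
      · exact absurd h1 (hlt j i h2).ne'
    subst hij
    have hne : mirror (p i) ≠ p i := fun h3 => by
      have := congrArg Complex.re h3
      rw [mirror_re] at this
      exact hpre i (by linarith)
    cases b <;> cases b'
    · rfl
    · exact absurd h (by simpa [he] using hne)
    · exact absurd h (by simpa [he] using hne.symm)
    · rfl
  have heT : ∀ jb, |(e jb).im - T| ≤ 1 / T := by
    rintro ⟨j, b⟩
    cases b
    · simpa [he] using hpT j
    · simpa [he] using hpT j
  have he0 : ∀ jb, F (e jb) = 0 := by
    rintro ⟨j, b⟩
    cases b
    · simpa [he] using hsymm _ (hpT j) (hp0 j)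
    · simpa [he] using hp0 j
  have hsum := sum_le_zeroCount (F := F) (U := {s : ℂ | |s.im - T| ≤ 1 / T})
    (Z := Finset.univ.image e) (by
      intro z hz
      obtain ⟨jb, -, rfl⟩ := Finset.mem_image.1 (Finset.mem_coe.1 hz)
      exact heT jb)
  have hcard : ((2 * J : ℕ) : ℕ∞) ≤ ∑ z ∈ Finset.univ.image e, zeroMult F z := by
    calc ((2 * J : ℕ) : ℕ∞) = ∑ z ∈ Finset.univ.image e, 1 := by
          rw [Finset.sum_const, Finset.card_image_of_injective _ hinj]
          simp [mul_comm]
      _ ≤ _ := by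
          refine Finset.sum_le_sum fun z hz => ?_
          obtain ⟨jb, -, rfl⟩ := Finset.mem_image.1 hz
          have han := hF _ (him _ (heT jb))
          rw [zeroMult_eq_analyticOrderAt han, Order.one_le_iff_ne_zero]
          exact han.analyticOrderAt_ne_zero.2 (he0 jb)
  rw [hn] at hsum
  have := hcard.trans hsum
  have : 2 * J ≤ n := by exact_mod_cast this
  omega

/-! ### Size estimates for large T and the conclusion. -/

lemma eventually_log_le {σ₁ c B κ : ℝ} (hσ₁ : 0 < σ₁) (hc : 0 < c) (hB : 0 < B) (hκ : 0 < κ) :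
    ∀ᶠ T : ℝ in Filter.atTop, κ * (Real.log ((T + 5 * σ₁) ^ B / c) + 1) ≤ T ^ 4 := by
  filter_upwards [Filter.eventually_ge_atTop 1,
    Filter.eventually_ge_atTop (κ * (B * (1 + 5 * σ₁) + |Real.log c| + 1))] with T h1 h2
  have hpos : 0 < T + 5 * σ₁ := by positivity
  rw [Real.log_div (Real.rpow_pos_of_pos hpos _).ne' hc.ne', Real.log_rpow hpos]
  have h3 : Real.log (T + 5 * σ₁) ≤ T * (1 + 5 * σ₁) :=
    (Real.log_le_self hpos.le).trans (by nlinarith)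
  have h4 := neg_abs_le (Real.log c)
  have h5 : B * Real.log (T + 5 * σ₁) - Real.log c + 1 ≤
      T * (B * (1 + 5 * σ₁) + |Real.log c| + 1) := by
    nlinarith [mul_le_mul_of_nonneg_left h3 hB.le, abs_nonneg (Real.log c)]
  calc κ * (B * Real.log (T + 5 * σ₁) - Real.log c + 1)
      ≤ κ * (T * (B * (1 + 5 * σ₁) + |Real.log c| + 1)) := by gcongr
    _ = T * (κ * (B * (1 + 5 * σ₁) + |Real.log c| + 1)) := by ring
    _ ≤ T * T := by gcongr
    _ ≤ T ^ 4 := by nlinarith [one_le_pow₀ (n := 2) h1]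

lemma eventually_ten_mul_log_le {ε : ℝ} (hε : 0 < ε) :
    ∀ᶠ T : ℝ in Filter.atTop, 10 * Real.log T ≤ T ^ (ε / 4) := by
  filter_upwards [(isLittleO_log_rpow_atTop (by positivity : 0 < ε / 4)).bound
    (by norm_num : (0 : ℝ) < 1 / 10), Filter.eventually_ge_atTop 1] with T h1 h2
  rw [Real.norm_eq_abs, Real.norm_eq_abs, abs_of_nonneg (Real.log_nonneg h2),
    abs_of_nonneg (Real.rpow_nonneg (by linarith) _)] at h1
  linarith

/-- The budget T^ε is split: T^(ε/4) absorbs 10 log T in the first exponent, and T^(3ε/4) pays for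
all the annuli. -/
lemma pow_floor_mul_le {ε δ A T : ℝ} (hδ : 0 < δ) (hε : 0 < ε) (hT : Real.exp 1 ≤ T) (hA : ε < A)
    (hlog : 10 * Real.log T ≤ T ^ (ε / 4)) :
    max (T ^ (A - ε)) (10 * Real.log T) *
      (14 / 5) ^ ⌊ε / Real.log (2 + δ) * Real.log T / 2⌋₊ ≤ T ^ A := by
  have hT0 : 0 < T := (Real.exp_pos 1).trans_le hT
  have hlogT : 1 ≤ Real.log T := (Real.le_log_iff_exp_le hT0).2 hT
  have hT1 : 1 ≤ T := (Real.one_le_exp zero_le_one).trans hT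
  have hlogδ : 0 < Real.log (2 + δ) := Real.log_pos (by linarith)
  have h1 : max (T ^ (A - ε)) (10 * Real.log T) ≤ T ^ (A - ε) * T ^ (ε / 4) := by
    have k1 : 1 ≤ T ^ (A - ε) := Real.one_le_rpow hT1 (by linarith)
    have k2 : 1 ≤ T ^ (ε / 4) := Real.one_le_rpow hT1 (by linarith)
    refine max_le ?_ ?_ <;> nlinarith
  have h2 : (14 / 5 : ℝ) ^ ⌊ε / Real.log (2 + δ) * Real.log T / 2⌋₊ ≤ T ^ (3 * ε / 4) := by
    have hq : 0 ≤ Real.log (14 / 5) := Real.log_nonneg (by norm_num)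
    have hq2 : Real.log (14 / 5) ≤ 3 / 2 * Real.log (2 + δ) := by
      -- (14/5)² = 7.84 < 8 ≤ (2 + δ)³.
      have a1 : (2 : ℕ) * Real.log (14 / 5) ≤ (3 : ℕ) * Real.log (2 + δ) := by
        rw [← Real.log_pow, ← Real.log_pow]
        refine Real.log_le_log (by positivity) ?_
        nlinarith [pow_pos hδ 2, pow_pos hδ 3]
      push_cast at a1
      linarith
    rw [← Real.rpow_natCast, Real.rpow_def_of_pos (by norm_num), Real.rpow_def_of_pos hT0]
    refine Real.exp_le_exp.2 ?_
    calc Real.log (14 / 5) * (⌊ε / Real.log (2 + δ) * Real.log T / 2⌋₊ : ℝ)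
        ≤ (3 / 2 * Real.log (2 + δ)) * (ε / Real.log (2 + δ) * Real.log T / 2) := by
          refine mul_le_mul hq2 (Nat.floor_le (by positivity)) (by positivity) (by positivity)
      _ = Real.log T * (3 * ε / 4) := by field_simp; ring
  calc _ ≤ (T ^ (A - ε) * T ^ (ε / 4)) * T ^ (3 * ε / 4) := by gcongr
    _ = T ^ A := by
      rw [← Real.rpow_add hT0, ← Real.rpow_add hT0]
      congr 1
      ring

/-- With r = exp(-x) and R = exp(-12x/5), R/r² = exp(-2x/5) ≤ 1/τ, which beats the factor Λ from the
zero count and from Landau's bound. -/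
lemma exp_radius_small {σ Λ x τ : ℝ} (hσ : 0 ≤ σ) (hΛ : 0 ≤ Λ) (hx : 0 ≤ x) (hτ : 0 < τ)
    (h : Real.exp (-(2 / 5 * x)) ≤ 1 / τ) (hτΛ : 4 * (12 + 64 * σ) * Λ ≤ τ) :
    (4 * (3 * Λ) / Real.exp (-x) ^ 2 + 64 * σ * Λ) * (2 * Real.exp (-(12 / 5 * x))) ≤ 1 / 2 := by
  have h1 : Real.exp (-(12 / 5 * x)) = Real.exp (-x) ^ 2 * Real.exp (-(2 / 5 * x)) := by
    rw [← Real.exp_nat_mul, ← Real.exp_add]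
    congr 1
    push_cast
    ring
  have hr0 := Real.exp_pos (-x)
  have hr1 : Real.exp (-x) ≤ 1 := Real.exp_le_one_iff.2 (by linarith)
  rw [h1]
  generalize Real.exp (-x) = ρ at *
  generalize Real.exp (-(2 / 5 * x)) = κ at *
  have h2 : ρ ^ 2 ≤ 1 := pow_le_one₀ hr0.le hr1
  have h3 : 0 ≤ σ * Λ := mul_nonneg hσ hΛ
  calc (4 * (3 * Λ) / ρ ^ 2 + 64 * σ * Λ) * (2 * (ρ ^ 2 * κ))
      = (12 * Λ + 64 * (σ * Λ) * ρ ^ 2) * (2 * κ) := by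
        field_simp
        ring
    _ ≤ (12 * Λ + 64 * (σ * Λ) * 1) * (2 * (1 / τ)) := by
        refine mul_le_mul (by nlinarith) (by linarith) ?_ (by positivity)
        -- The sign of κ, lost by `generalize`, is recovered from ρ²κ = exp(-12x/5) > 0.
        by_contra hneg
        push Not at hneg
        have : ρ ^ 2 * κ < 0 := mul_neg_of_pos_of_neg (by positivity) (by linarith)
        have := Real.exp_pos (-(12 / 5 * x))
        linarith
    _ = (4 * (12 + 64 * σ) * Λ) / (2 * τ) := by field_simp; ring
    _ ≤ 1 / 2 := by
        rw [div_le_iff₀ (by positivity)]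
        linarith

/-- The radii r, R, r₁ have exponents x, 12x/5, 14x/5: R must be far below r², so its factor exceeds
2, and r₁ far below R. Landau's factorization is centred at σ₁ + iT, where |F| ≥ c; its disc of
radius 5σ₁ reaches exactly to σ = -4σ₁, and those of radius σ₁ and 2σ₁ contain the discs of radius
1/2 and 1 around 1/2 + iT. -/
lemma exists_localData {F : ℂ → ℂ} {σ₁ c B T x : ℝ} (hσ₁ : 1 < σ₁) (hc : 0 < c) (hB : 0 < B)
    (hF : DifferentiableOn ℂ F {s | 0 < s.im}) (hlower : c ≤ ‖F ((σ₁ : ℂ) + T * I)‖)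
    (hupper : ∀ σ T : ℝ, 10 < T → -4 * σ₁ ≤ σ → ‖F ((σ : ℂ) + T * I)‖ < T ^ B)
    (hT10 : 10 + 5 * σ₁ < T) (hline : ∀ s : ℂ, T - 1 < s.im → s.re = 1 / 2 → F s ≠ 0 →
      (logDeriv F s).re ≤ -1)
    (hord : ∀ p : ℂ, T - 1 < p.im → ∀ n : ℕ, analyticOrderAt F (mirror p) = n →
      analyticOrderAt F p = n)
    (hsymm : ∀ p : ℂ, T - 1 < p.im → F p = 0 → F (mirror p) = 0)
    (hj : ∀ p : ℂ, F p = 0 → p.re ≠ 1 / 2 → ‖p - (1 / 2 + T * I)‖ < Real.exp (-x) →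
      ‖p - (1 / 2 + T * I)‖ ≤ Real.exp (-(14 / 5 * x)))
    (hxlog : 10 * Real.log T ≤ x)
    (hlogM : 4 * (12 + 64 * σ₁) * (Real.log ((T + 5 * σ₁) ^ B / c) + 1) ≤ T ^ 4) :
    ∃ (N V : ℝ) (Z : Finset ℂ) (m : ℂ → ℕ) (H : ℂ → ℂ),
      LocalData F T N V (Real.exp (-x)) (Real.exp (-(14 / 5 * x))) (Real.exp (-(12 / 5 * x)))
        Z m H := by
  have hT0 : 0 < T := by linarith
  have hT15 : 15 < T := by linarith
  have hlogT0 : 0 ≤ Real.log T := Real.log_nonneg (by linarith)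
  set a : ℂ := (σ₁ : ℂ) + T * I with ha
  set M : ℝ := (T + 5 * σ₁) ^ B with hM
  set Λ : ℝ := Real.log (M / c) + 1 with hΛ
  have hball5 : ∀ s ∈ Metric.closedBall a (5 * σ₁), -4 * σ₁ ≤ s.re ∧ 10 < s.im ∧
      s.im ≤ T + 5 * σ₁ := by
    intro s hs
    rw [Metric.mem_closedBall, dist_eq_norm] at hs
    have h1 := (abs_re_le_norm (s - a)).trans hs
    have h2 := (abs_im_le_norm (s - a)).trans hs
    have e1 : (s - a).re = s.re - σ₁ := by simp [ha]
    have e2 : (s - a).im = s.im - T := by simp [ha]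
    rw [e1, abs_le] at h1
    rw [e2, abs_le] at h2
    exact ⟨by linarith [h1.1], by linarith [h2.1], by linarith [h2.2]⟩
  obtain ⟨Z, m, H, hZ, hm, hH, hHK, hFH, hsum, hderiv⟩ := exists_landau_factorization
    isOpen_im_pos hF (a := a) (M := M) hσ₁
    (fun s hs => show 0 < s.im by linarith [(hball5 s hs).2.1])
    (fun s hs => by
      obtain ⟨h1, h2, h3⟩ := hball5 s hs
      have h4 := hupper s.re s.im h2 h1
      rw [re_add_im] at h4
      exact h4.le.trans (Real.rpow_le_rpow (by linarith) h3 hB.le))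
    hc hlower
  rw [← hΛ] at hderiv
  have hca : ∀ {s : ℂ} {ρ : ℝ}, ‖s - (1 / 2 + T * I)‖ < ρ → ‖s - a‖ < ρ + (σ₁ - 1 / 2) := by
    intro s ρ hs
    have h1 := norm_add_le (s - (1 / 2 + T * I)) ((1 / 2 + T * I) - a)
    rw [sub_add_sub_cancel] at h1
    have h2 : (1 / 2 + T * I) - a = ((1 / 2 - σ₁ : ℝ) : ℂ) := by rw [ha]; push_cast; ring
    rw [h2, norm_real, Real.norm_eq_abs, abs_of_neg (by linarith)] at h1
    linarith
  have him : ∀ {s : ℂ}, ‖s - (1 / 2 + T * I)‖ < 1 → T - 1 < s.im := by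
    intro s hs
    linarith [(abs_lt.1 ((abs_im_sub_le s T).trans_lt hs)).1]
  have hmemK : ∀ {s : ℂ}, ‖s - (1 / 2 + T * I)‖ < 1 → s ∈ Metric.closedBall a (2 * σ₁) := by
    intro s hs
    rw [Metric.mem_closedBall, dist_eq_norm]
    linarith [hca hs]
  have hΛ1 : (∑ p ∈ Z, (m p : ℝ)) ≤ 3 * Λ := by
    have h1 : (1 / 3 : ℝ) ≤ Real.log (3 / 2) := by
      have := Real.one_sub_inv_le_log_of_pos (x := 3 / 2) (by norm_num)
      norm_num at this ⊢
      linarith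
    have h2 : 0 ≤ ∑ p ∈ Z, (m p : ℝ) := Finset.sum_nonneg fun p _ => by positivity
    have h3 := mul_le_mul_of_nonneg_left h1 h2
    linarith
  have hΛ0 : 0 ≤ Λ := by
    have h2 : 0 ≤ ∑ p ∈ Z, (m p : ℝ) := Finset.sum_nonneg fun p _ => by positivity
    linarith
  have hx0 : 0 ≤ x := by linarith
  have hmul : ∀ u v : ℝ, Real.exp (-(u * x)) * Real.exp (-(v * x)) = Real.exp (-((u + v) * x)) := by
    intro u v
    rw [← Real.exp_add]
    congr 1
    ring
  -- This is the use of x ≥ 10 log T.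
  have hexp25 : Real.exp (-(2 / 5 * x)) ≤ 1 / T ^ (4 : ℕ) := by
    have h4 : T ^ (4 : ℕ) = Real.exp (4 * Real.log T) := by
      rw [← Real.exp_log (pow_pos hT0 4), Real.log_pow]
      push_cast
      rfl
    rw [h4, one_div, ← Real.exp_neg]
    exact Real.exp_le_exp.2 (by linarith)
  have hT4 : 15 ^ 4 ≤ T ^ 4 := pow_le_pow_left₀ (by norm_num) hT15.le 4
  have hexp25' : Real.exp (-(2 / 5 * x)) ≤ 1 / 8 :=
    hexp25.trans (one_div_le_one_div_of_le (by norm_num) (by linarith))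
  have hr1 : Real.exp (-x) ≤ 1 := Real.exp_le_one_iff.2 (by linarith)
  refine ⟨3 * Λ, 64 * σ₁ * Λ, Z, m, H, ?_⟩
  refine ⟨?_, ?_, ?_, fun p hp => (hm p hp).2, hΛ1, ?_, ?_, ?_, Real.exp_pos _, ?_, ?_, hr1, ?_⟩
  · intro s hs
    rw [Metric.mem_ball, dist_eq_norm] at hs
    have hs0 : 0 < s.im := by linarith [him hs]
    exact (hH.differentiableAt (isOpen_im_pos.mem_nhds hs0)).differentiableWithinAt
  · intro s hs
    rw [Metric.mem_ball, dist_eq_norm] at hs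
    exact hHK s (hmemK hs)
  · intro s hs
    rw [Metric.mem_ball, dist_eq_norm] at hs
    exact hFH s (show 0 < s.im by linarith [him hs])
  · intro s hs
    rw [Metric.mem_ball, dist_eq_norm] at hs
    refine hderiv s ?_
    rw [Metric.mem_ball, dist_eq_norm]
    linarith [hca hs]
  · intro s hs hre h0
    rw [Metric.mem_ball, dist_eq_norm] at hs
    have hs1 := him (hs.trans (by norm_num))
    exact hline s hs1 hre h0
  · intro p hp hpre hpr
    obtain ⟨hpK, hp0⟩ := (hZ p).1 hp
    have hp1 := hpr.trans_le hr1
    have hpim := him hp1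
    have hmp : mirror p ∈ Z := (hZ _).2 ⟨hmemK (by rwa [norm_mirror_sub]), hsymm p hpim hp0⟩
    refine ⟨hj p hp0 hpre hpr, hmp, ?_⟩
    have h1 := hord p hpim _ (hm _ hmp).1
    rw [(hm p hp).1] at h1
    exact_mod_cast h1.symm
  · have := hmul (12 / 5) (2 / 5)
    norm_num at this
    rw [← this]
    have := Real.exp_pos (-(12 / 5 * x))
    nlinarith
  · have := hmul 1 (7 / 5)
    norm_num at this
    rw [← this]
    have h1 : Real.exp (-(7 / 5 * x)) ≤ 1 / 8 :=
      (Real.exp_le_exp.2 (by linarith)).trans hexp25'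
    have := Real.exp_pos (-x)
    nlinarith
  · exact exp_radius_small (by linarith) hΛ0 hx0 (pow_pos hT0 4) hexp25 hlogM

theorem theorem2 (σ₁ c B ε δ Tbar : ℝ) (hσ₁ : 1 < σ₁) (hc : 0 < c) (hB : 0 < B) (hε : 0 < ε)
    (hδ : 0 < δ) (hTbar : 0 < Tbar) (r : ℕ) (lam : Fin r → ℝ) (mu : Fin r → ℂ)
    (hlam : ∀ j, 0 < lam j) (hmu : ∀ j, 0 ≤ (mu j).re) (hdeg : 0 < selbergDegree lam) :
    ∃ T₀ : ℝ, 0 < T₀ ∧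
      ∀ F : ℂ → ℂ, InSubclass σ₁ c B ε δ Tbar lam mu F →
        ∀ A T σ₀ : ℝ, ε < A → T₀ < T →
          1 / 2 - Real.exp (-T ^ A) < σ₀ → σ₀ ≤ 1 / 2 →
          ∃ R : ℝ, Real.exp (-T ^ A) ≤ R ∧ R ≤ Real.exp (-T ^ (A - ε)) ∧
            ∃ n : ℕ,
              zeroCount F {s : ℂ | ‖s - ((σ₀ : ℂ) + T * Complex.I)‖ ≤ R ∧ s.re < 1 / 2} = n ∧
              zeroCount (deriv F)
                {s : ℂ | ‖s - ((σ₀ : ℂ) + T * Complex.I)‖ ≤ R ∧ s.re < 1 / 2} = n := by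
  obtain ⟨Q₀, hQ₀, hQ⟩ := exists_conductor_lower_bound (mu := mu) hσ₁ hc hB hlam
  obtain ⟨t₁, ht₁⟩ := eventually_logDeriv_re_le hlam hmu hdeg hQ₀
  obtain ⟨t₂, ht₂⟩ := (eventually_isHigh (mu := mu) hlam).exists
  obtain ⟨T₀, hT₀⟩ := Filter.eventually_atTop.1
    ((eventually_log_le (σ₁ := σ₁) (κ := 4 * (12 + 64 * σ₁)) (by linarith) hc hB (by positivity)).and
      (eventually_ten_mul_log_le hε))
  refine ⟨max (max T₀ Tbar) (max (max (t₁ + 1) (t₂ + 1)) (10 + 5 * σ₁)),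
    lt_max_of_lt_right (lt_max_of_lt_right (by linarith)), ?_⟩
  intro F hF A T σ₀ hA hT hσ₀ hσ₀'
  simp only [max_lt_iff] at hT
  obtain ⟨⟨hTT₀, hTTbar⟩, ⟨hTt₁, hTt₂⟩, hT10⟩ := hT
  obtain ⟨hlogM, hlogT⟩ := hT₀ T hTT₀.le
  have hT15 : 15 < T := by linarith
  have hT0 : 0 < T := by linarith
  have hTe : Real.exp 1 ≤ T := by linarith [Real.exp_one_lt_d9]
  have hlogT1 : 1 ≤ Real.log T := (Real.le_log_iff_exp_le hT0).2 hTe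
  obtain ⟨Q, ω, hQpos, hω, hFE⟩ := hF.functional
  have hQQ := hQ F Q ω hQpos hω hFE (fun s hs => hF.selberg.differentiableAt_of_im_pos hs)
    hF.lower hF.upper
  have han : ∀ s : ℂ, 0 < s.im → AnalyticAt ℂ F s := fun s hs => hF.selberg.analyticAt hs
  have hord : ∀ {p : ℂ}, t₂ < p.im → ∀ {n : ℕ}, analyticOrderAt F (mirror p) = n →
      analyticOrderAt F p = n := fun hp _ hn =>
    analyticOrderAt_mirror hlam hQpos hω hFE han ht₂ hp hn
  have hT1 : 1 / T ≤ 1 := by rw [div_le_one hT0]; linarith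
  obtain ⟨n, hn, hn'⟩ := hF.zeros T hTTbar
  set J := ⌊ε / Real.log (2 + δ) * Real.log T / 2⌋₊ with hJ
  -- T^(A - ε) yields the upper bound for the radius. As A may be arbitrarily close to ε while `T₀`
  -- is independent of A, the term 10 log T is needed to make the radii small compared with powers
  -- of T.
  set x₀ := max (T ^ (A - ε)) (10 * Real.log T) with hx₀
  have hx₀log : 10 * Real.log T ≤ x₀ := le_max_right _ _
  -- The summand -2 in the bound on the number of zeros compensates for the rounding in J.
  have hnJ : n < 2 * J := by
    have h1 := Nat.lt_floor_add_one (ε / Real.log (2 + δ) * Real.log T / 2)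
    rw [← hJ] at h1
    have : (n : ℝ) < 2 * J := by linarith
    exact_mod_cast this
  have hsymm : ∀ p : ℂ, t₂ < p.im → F p = 0 → F (mirror p) = 0 := by
    intro p hp h0
    have hp' : t₂ < (mirror p).im := by rwa [mirror_im]
    have hpa := han _ (ht₂.1.trans hp')
    -- A nonzero value is order 0, which the symmetry of orders carries over to `p`.
    by_contra h
    have h1 : analyticOrderAt F (mirror p) = (0 : ℕ) := by
      exact_mod_cast hpa.analyticOrderAt_eq_zero.2 h
    have h2 := hord hp h1
    exact (han p (ht₂.1.trans hp)).analyticOrderAt_eq_zero.1 (by exact_mod_cast h2) h0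
  have hexpx : Real.exp (-x₀) ≤ 1 / T := by
    rw [one_div, ← Real.exp_log (inv_pos.2 hT0), Real.log_inv]
    exact Real.exp_le_exp.2 (by linarith)
  obtain ⟨j, hjJ, hj⟩ := exists_annulus_of_zeroCount_lt (F := F) (T := T) (x₀ := x₀) (q := 14 / 5)
    (by linarith) (by linarith) (by norm_num)
    hexpx han
    (fun p hp => hsymm p (by linarith [(abs_le.1 hp).1])) hn hnJ
  set x := x₀ * (14 / 5) ^ j with hx
  have hpow1 : (1 : ℝ) ≤ (14 / 5) ^ j := one_le_pow₀ (by norm_num)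
  have hxx₀ : x₀ ≤ x := le_mul_of_one_le_right (by linarith) hpow1
  have hxlog : 10 * Real.log T ≤ x := hx₀log.trans hxx₀
  have hxA : 14 / 5 * x ≤ T ^ A := by
    refine le_trans ?_ (pow_floor_mul_le hδ hε hTe hA hlogT)
    rw [← hx₀, ← hJ, hx]
    calc 14 / 5 * (x₀ * (14 / 5) ^ j) = x₀ * (14 / 5) ^ (j + 1) := by ring
      _ ≤ x₀ * (14 / 5) ^ J := by
        have : (14 / 5 : ℝ) ^ (j + 1) ≤ (14 / 5) ^ J := pow_le_pow_right₀ (by norm_num) hjJ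
        have : 0 ≤ x₀ := by linarith
        gcongr
  have hx1 : x₀ * (14 / 5) ^ (j + 1) = 14 / 5 * x := by rw [hx]; ring
  rw [hx1] at hj
  obtain ⟨N, V, Z, m, H, hdata⟩ := exists_localData hσ₁ hc hB hF.selberg.differentiableOn
    (hF.lower T) hF.upper hT10
    (fun s hs => ht₁ F Q ω hQQ hω hFE s (by linarith)
      (hF.selberg.differentiableAt_of_im_pos (by linarith)))
    (fun p hp n => hord (by linarith)) (fun p hp => hsymm p (by linarith)) hj hxlog hlogM
  have hx0 : 0 ≤ x := by linarith
  refine ⟨Real.exp (-(12 / 5 * x)), ?_, ?_, hdata.zeroCount_eq ?_ hσ₀'⟩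
  · exact Real.exp_le_exp.2 (by linarith)
  · have : T ^ (A - ε) ≤ x := (le_max_left _ _).trans hxx₀
    exact Real.exp_le_exp.2 (by linarith)
  · have : Real.exp (-T ^ A) ≤ Real.exp (-(14 / 5 * x)) := Real.exp_le_exp.2 (by linarith)
    linarith
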